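/- **Setting.** Let $M\subset\mathbb R^n$ be open and let $\phi:M\to\mathbb R$ be smooth with $g(x)=\nabla^2\phi(x)$ positive definite for every $x\in M$; regard $M$ as a Riemannian (Hessian) manifold with metric $g$, write $\langle u,v\rangle_x=u^{T}g(x)v$, $\|v\|_x=\sqrt{\langle v,v\rangle_x}$, and let $\exp_x$ be its exponential map, $\exp_x(v)=c(1)$ for the geodesic $c:[0,1]\to M$ with $c(0)=x$, $c'(0)=v$. Let $\mu_i(x)=\frac12\sum_j\frac{\partial}{\partial x_j}\big((\nabla^2\phi(x))^{-1}\big)_{ij}$ be the drift. For a step size $h>0$ put $\ell=\ell(h)=\sqrt{nh}$. The probability density (in Euclidean coordinates, before the Metropolis filter) of going from $x$ to $y=\exp_x(v)$ by the step $v\in T_xM$ is $$p(x\overset{v}{\rightarrow}y)=\det\big(d\exp_x(v)\big)^{-1}\sqrt{\frac{\det g(y)}{(2\pi h)^n}}\;\exp\Big(-\frac12\Big\|\frac{v-\frac h2\mu(x)}{\sqrt h}\Big\|_x^2\Big),$$ where $\det(d\exp_x(v))$ is taken with respect to positively oriented orthonormal bases of $T_xM$ and $T_yM$. Let $V(\gamma)$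 be a real-valued function of geodesics $\gamma:[0,\ell]\to M$ (a function of the step size $h$ and of $(\gamma(0),\gamma'(0))$), let $V_0,H\in\mathbb R$, and define in $[0,\infty]$ $$D_1=\sup\Big|\frac{d}{dt}\|\mu(\gamma(t))\|_{\gamma(t)}^2\Big|,\qquad G_1=\sup\Big|\frac{d^3}{dt^3}\log\det g(\gamma(t))\Big|,\qquad R_1=\sup\|R(t)\|_F,$$ where each supremum is over all $0<h'\le H$, all geodesics $\gamma:[0,\ell(h')]\to M$ with $V(\gamma)\le V_0$, and all $0\le t\le\ell(h')$. Here $R(t)u=R(u,\gamma'(t))\gamma'(t)$ with $R(\cdot,\cdot)\cdot$ the Riemann curvature tensor, and $\|A\|_F=\big(\sum_{i,j}\langle v_i,Av_j\rangle^2\big)^{1/2}$ for an orthonormal basis $(v_i)$ of the tangent space. **Theorem.** There is a universal constant $C>0$ such that the following holds in every such setting. Let $h>0$ satisfy $h\le\min\big(H,\frac1{nR_1}\big)$ (with $\frac1{nR_1}=\infty$ if $nR_1=0$, and $0\cdot\infty=0$), put $\ell=\sqrt{nh}$, and let $\gamma:[0,\ell]\to M$ be a geodesic with $V(\gamma)\le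 V_0$. Put $x=\gamma(0)$, $y=\gamma(\ell)$, $v_x=\ell\gamma'(0)$ and $v_y=-\ell\gamma'(\ell)$. Then $\exp_x(v_x)=y$, $\exp_y(v_y)=x$, both densities $p(x\overset{v_x}{\rightarrow}y)$ and $p(y\overset{v_y}{\rightarrow}x)$ are positive, and $$\left|\log\frac{p(x\overset{v_x}{\rightarrow}y)}{p(y\overset{v_y}{\rightarrow}x)}\right|\le C\left(\sqrt n\,h^{3/2}D_1+(nh)^{3/2}G_1+(nhR_1)^2\right).$$ In particular the probability $1-\min\Big(1,\frac{p(y\overset{v_y}{\rightarrow}x)}{p(x\overset{v_x}{\rightarrow}y)}\Big)$ that the Metropolis filter rejects this step is at most the same right-hand side. -/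

import Mathlib

namespace GeodesicWalk

open scoped ContDiff ENNReal Matrix

noncomputable section

/- Points and tangent vectors are coordinate vectors `Fin n → ℝ`. Only the topology, the linear
structure and the coordinates of this space are used below, never its norm: every length and
inner product is taken in the Riemannian metric. -/

/-- The partial derivative `∂f/∂xᵢ` at `x`. -/
def pderiv {n : ℕ} (i : Fin n) (f : (Fin n → ℝ) → ℝ) (x : Fin n → ℝ) : ℝ :=
  fderiv ℝ f x (Pi.single i 1)

/-- The Hessian matrix `∇²φ(x)`. -/
def hessian {n : ℕ} (φ : (Fin n → ℝ) → ℝ) (x : Fin n → ℝ) : Matrix (Fin n) (Fin n) ℝ :=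
  Matrix.of fun i j => pderiv i (pderiv j φ) x

/-- A Hessian manifold of dimension `n`: an open subset of `ℝⁿ` with a smooth function on it whose
Hessian is positive definite at every point; the metric is this Hessian. -/
structure HessianManifold (n : ℕ) where
  carrier : Set (Fin n → ℝ)
  potential : (Fin n → ℝ) → ℝ
  isOpen : IsOpen carrier
  smooth : ContDiffOn ℝ ∞ potential carrier
  posDef : ∀ x ∈ carrier, (hessian potential x).PosDef

variable {n : ℕ} (M : HessianManifold n)

/-- The metric `g(x) = ∇²φ(x)`. -/
def metric (x : Fin n → ℝ) : Matrix (Fin n) (Fin n) ℝ := hessian M.potential x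

/-- The inner product `⟨u, v⟩_x = uᵀ g(x) v`. -/
def metricInner (x u v : Fin n → ℝ) : ℝ := u ⬝ᵥ (metric M x *ᵥ v)

/-- The norm `‖v‖_x`. -/
def metricNorm (x v : Fin n → ℝ) : ℝ := √(metricInner M x v v)

/-- The Christoffel symbols `Γᵏᵢⱼ` of the Levi-Civita connection of `g`. -/
def christoffel (x : Fin n → ℝ) (k i j : Fin n) : ℝ :=
  (1 / 2) * ∑ l, (metric M x)⁻¹ k l *
    (pderiv i (fun z => metric M z j l) x + pderiv j (fun z => metric M z i l) x
      - pderiv l (fun z => metric M z i j) x)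

/-- The component `Rᵏₗᵢⱼ` of the Riemann curvature tensor,
`R(∂ᵢ, ∂ⱼ) ∂ₗ = ∑ₖ Rᵏₗᵢⱼ ∂ₖ` with `R(u, v) w = ∇ᵤ∇ᵥw - ∇ᵥ∇ᵤw - ∇_[u,v] w`. -/
def riemannCoeff (x : Fin n → ℝ) (k l i j : Fin n) : ℝ :=
  pderiv i (fun z => christoffel M z k j l) x - pderiv j (fun z => christoffel M z k i l) x
    + ∑ m, (christoffel M x k i m * christoffel M x m j l
      - christoffel M x k j m * christoffel M x m i l)

/-- The Riemann curvature tensor: the tangent vector `R(u, v) w` at `x`. -/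
def riemann (x u v w : Fin n → ℝ) : Fin n → ℝ :=
  fun k => ∑ i, ∑ j, ∑ l, riemannCoeff M x k l i j * u i * v j * w l

/-- The linear map `u ↦ R(u, v) v` of `T_x M`, as a matrix in the coordinate basis. -/
def jacobiOperator (x v : Fin n → ℝ) : Matrix (Fin n) (Fin n) ℝ :=
  Matrix.of fun k i => riemann M x (Pi.single i 1) v v k

/-- The Frobenius norm at `x` of a linear map `A` of `T_x M`: `√tr(A* A)` with the adjoint
`A* = g⁻¹ Aᵀ g`. See `frobeniusNorm_eq` for its expression in an orthonormal basis. -/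
def frobeniusNorm (x : Fin n → ℝ) (A : Matrix (Fin n) (Fin n) ℝ) : ℝ :=
  √(((metric M x)⁻¹ * Aᵀ * metric M x * A).trace)

/-- If the columns of `P` are an orthonormal basis `p₁, …, pₙ` of `T_x M`, then
`‖A‖_F = √(∑ᵢⱼ ⟨pᵢ, A pⱼ⟩²)`. -/
theorem frobeniusNorm_eq (x : Fin n → ℝ) (A P : Matrix (Fin n) (Fin n) ℝ)
    (hP : ∀ i j, metricInner M x (fun k => P k i) (fun k => P k j) = if i = j then 1 else 0)
    (hg : (metric M x).IsSymm) :
    frobeniusNorm M x A =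
      √(∑ i, ∑ j, metricInner M x (fun k => P k i) (A *ᵥ fun k => P k j) ^ 2) := by
  have h1 : Pᵀ * metric M x * P = 1 := by
    ext i j
    rw [Matrix.one_apply, ← hP i j, Matrix.mul_assoc]
    rfl
  have h2 : P * (Pᵀ * metric M x) = 1 := mul_eq_one_comm.mp h1
  have h3 : (metric M x)⁻¹ = P * Pᵀ := by
    apply Matrix.inv_eq_left_inv
    rw [Matrix.mul_assoc, h2]
  have h4 : ∀ i j, metricInner M x (fun k => P k i) (A *ᵥ fun k => P k j)
      = (Pᵀ * metric M x * A * P) i j := by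
    intro i j
    rw [Matrix.mul_assoc, Matrix.mul_assoc]
    rfl
  have h5 : ∑ i, ∑ j, metricInner M x (fun k => P k i) (A *ᵥ fun k => P k j) ^ 2
      = ((Pᵀ * metric M x * A * P)ᵀ * (Pᵀ * metric M x * A * P)).trace := by
    simp only [h4, Matrix.trace, Matrix.diag_apply, Matrix.mul_apply (M := (_)ᵀ),
      Matrix.transpose_apply]
    rw [Finset.sum_comm]
    refine Finset.sum_congr rfl fun j _ => Finset.sum_congr rfl fun i _ => ?_
    rw [sq]
  rw [frobeniusNorm, h5, h3]
  congr 1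
  have h6 : (Pᵀ * metric M x * A * P)ᵀ * (Pᵀ * metric M x * A * P)
      = Pᵀ * Aᵀ * metric M x * (P * (Pᵀ * metric M x)) * A * P := by
    simp only [Matrix.transpose_mul, Matrix.transpose_transpose, hg.eq, Matrix.mul_assoc]
  have h7 : P * Pᵀ * Aᵀ * metric M x * A = P * (Pᵀ * Aᵀ * metric M x * A) := by
    simp only [Matrix.mul_assoc]
  rw [h6, h2, Matrix.mul_one, h7, Matrix.trace_mul_comm]

/-- The drift `μᵢ(x) = ½ ∑ⱼ ∂/∂xⱼ (∇²φ(x)⁻¹)ᵢⱼ`. -/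
def drift (x : Fin n → ℝ) : Fin n → ℝ :=
  fun i => (1 / 2) * ∑ j, pderiv j (fun z => (metric M z)⁻¹ i j) x

/-- The velocity `γ'(t)` of a curve `γ : [0, T] → ℝⁿ` (one-sided at the end points). -/
def velocity (γ : ℝ → Fin n → ℝ) (T t : ℝ) : Fin n → ℝ := derivWithin γ (Set.Icc 0 T) t

/-- `γ : [0, T] → M` is a geodesic: `∇_{γ'} γ' = 0`, in coordinates
`γₖ'' + ∑ᵢⱼ Γᵏᵢⱼ(γ) γᵢ' γⱼ' = 0`. -/
structure IsGeodesic (T : ℝ) (γ : ℝ → Fin n → ℝ) : Prop where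
  mem : ∀ t ∈ Set.Icc 0 T, γ t ∈ M.carrier
  contDiffOn : ContDiffOn ℝ 2 γ (Set.Icc 0 T)
  equation : ∀ t ∈ Set.Icc 0 T, ∀ k,
    derivWithin (velocity γ T) (Set.Icc 0 T) t k
      + ∑ i, ∑ j, christoffel M (γ t) k i j * velocity γ T t i * velocity γ T t j = 0

open Classical in
/-- The exponential map: `exp_x(v) = γ(1)` for the geodesic `γ : [0, 1] → M` with `γ(0) = x`,
`γ'(0) = v` (unique if it exists; the value is `x` by convention if there is none). -/
def expMap (x v : Fin n → ℝ) : Fin n → ℝ :=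
  if h : ∃ γ : ℝ → Fin n → ℝ, IsGeodesic M 1 γ ∧ γ 0 = x ∧ velocity γ 1 0 = v then h.choose 1
  else x

/-- The determinant of a linear map `L : T_x M → T_y M` in orthonormal bases of `T_x M` and `T_y M`
with the standard orientation of `ℝⁿ`: the determinant of `g(y)^{1/2} L g(x)^{-1/2}`. -/
def metricDet (x y : Fin n → ℝ) (L : (Fin n → ℝ) →L[ℝ] (Fin n → ℝ)) : ℝ :=
  √(metric M y).det * L.det / √(metric M x).det

/-- The probability density `p(x →ᵛ y)` (in Euclidean coordinates, before the filter) of going from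
`x` to `y = exp_x(v)` with step size `h` by the tangent vector `v`:
`det(d exp_x(v))⁻¹ √(det g(y) / (2πh)ⁿ) exp(-½ ‖(v - (h/2) μ(x)) / √h‖_x²)`. -/
def stepDensity (h : ℝ) (x v : Fin n → ℝ) : ℝ :=
  (metricDet M x (expMap M x v) (fderiv ℝ (expMap M x) v))⁻¹
    * √((metric M (expMap M x v)).det / (2 * Real.pi * h) ^ n)
    * Real.exp (-(1 / 2) * metricNorm M x ((√h)⁻¹ • (v - (h / 2) • drift M x)) ^ 2)

/-- The length `ℓ = √(nh)` of the parameter interval of the geodesics with step size `h`. -/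
def stepLength (n : ℕ) (h : ℝ) : ℝ := √(n * h)

/-- `γ` is a geodesic `[0, ℓ] → M`, `ℓ = √(nh)`, with `V(γ) ≤ V₀`. The auxiliary function `V` is
given on the tangent bundle, `V(γ) = V h (γ(0)) (γ'(0))`, and may depend on the step size `h`. -/
structure IsGoodGeodesic (V : ℝ → (Fin n → ℝ) → (Fin n → ℝ) → ℝ) (V₀ h : ℝ)
    (γ : ℝ → Fin n → ℝ) : Prop where
  isGeodesic : IsGeodesic M (stepLength n h) γ
  aux_le : V h (γ 0) (velocity γ (stepLength n h) 0) ≤ V₀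

/-- The supremum of `F(γ, ℓ, t)` over `0 < h ≤ H`, geodesics `γ : [0, ℓ] → M` with `ℓ = √(nh)` and
`V(γ) ≤ V₀`, and `0 ≤ t ≤ ℓ`. -/
def goodSup (V : ℝ → (Fin n → ℝ) → (Fin n → ℝ) → ℝ) (V₀ H : ℝ)
    (F : (ℝ → Fin n → ℝ) → ℝ → ℝ → ℝ) : ℝ≥0∞ :=
  ⨆ (h : ℝ) (_ : 0 < h) (_ : h ≤ H) (γ : ℝ → Fin n → ℝ) (_ : IsGoodGeodesic M V V₀ h γ)
    (t : ℝ) (_ : t ∈ Set.Icc 0 (stepLength n h)), ENNReal.ofReal (F γ (stepLength n h) t)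

/-- The smoothness of the norm of the drift: `D₁ = sup |d/dt ‖μ(γ(t))‖²_{γ(t)}|`. -/
def paramD1 (V : ℝ → (Fin n → ℝ) → (Fin n → ℝ) → ℝ) (V₀ H : ℝ) : ℝ≥0∞ :=
  goodSup M V V₀ H fun γ T t =>
    |derivWithin (fun s => metricNorm M (γ s) (drift M (γ s)) ^ 2) (Set.Icc 0 T) t|

/-- The smoothness of the local volume: `G₁ = sup |(log det g(γ(t)))'''|`. -/
def paramG1 (V : ℝ → (Fin n → ℝ) → (Fin n → ℝ) → ℝ) (V₀ H : ℝ) : ℝ≥0∞ :=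
  goodSup M V V₀ H fun γ T t =>
    |iteratedDerivWithin 3 (fun s => Real.log (metric M (γ s)).det) (Set.Icc 0 T) t|

/-- The stability of the Jacobi field: `R₁ = sup ‖R(t)‖_F`, `R(t) u = R(u, γ'(t)) γ'(t)`. -/
def paramR1 (V : ℝ → (Fin n → ℝ) → (Fin n → ℝ) → ℝ) (V₀ H : ℝ) : ℝ≥0∞ :=
  goodSup M V V₀ H fun γ T t => frobeniusNorm M (γ t) (jacobiOperator M (γ t) (velocity γ T t))

/-- The error term `√n h^{3/2} D₁ + (nh)^{3/2} G₁ + (nh R₁)²`. -/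
def errorTerm (V : ℝ → (Fin n → ℝ) → (Fin n → ℝ) → ℝ) (V₀ H h : ℝ) : ℝ≥0∞ :=
  ENNReal.ofReal (√n * h ^ (3 / 2 : ℝ)) * paramD1 M V V₀ H
    + ENNReal.ofReal ((n * h) ^ (3 / 2 : ℝ)) * paramG1 M V V₀ H
    + (ENNReal.ofReal (n * h) * paramR1 M V V₀ H) ^ 2

/-- The probability that the Metropolis filter rejects the step from `x` to `y` along `vx`, whose
reverse step is the one from `y` to `x` along `vy`: acceptance has probability
`min(1, p(y →^{vy} x) / p(x →^{vx} y))`. -/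
def rejectionProb (h : ℝ) (x vx y vy : Fin n → ℝ) : ℝ :=
  1 - min 1 (stepDensity M h y vy / stepDensity M h x vx)

end

end GeodesicWalk

/-! Each density is a volume distortion times a factor √det g at the endpoint times a Gaussian
factor, and the logarithm of the ratio is computed exactly before anything is estimated.

The distortion of exp is the determinant of the Jacobi fields that vanish at one end. The Wronskian
of two Jacobi fields is constant, so the differentials of exp_x at v_x and of exp_y at v_y are
adjoint for the metric (`metricForm_jacobiField_symm`), and the two distortions are equal
(`IsGeodesicFlow.metricDet_pos_and_eq`). Curvature therefore matters only for positivity: h ≤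
1/(nR₁) makes the curvature operator along the geodesic rescaled to [0, 1] at most 1, and a
comparison argument then excludes conjugate points (`IsJacobiField.eq_zero_of_vanish`).

In the Gaussian factors the terms ‖v‖²/h cancel because geodesics have constant speed. Since μ = -½
grad log det g (`metricForm_drift`), the cross terms ⟨μ, v⟩ are endpoint derivatives of f = log det
g ∘ γ. Together with the factors √det g they form half the trapezoidal error f(ℓ) - f(0) -
(ℓ/2)(f'(0) + f'(ℓ)), which is bounded by a multiple of ℓ³ sup|f'''| ≤ (nh)^{3/2} G₁
(`abs_trapezoid_error_le`). What remains is h/8 times the change of ‖μ‖², at most hℓD₁/8 with hℓ =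
√n h^{3/2}. Hence C = 1 works, and the term (nhR₁)² is only slack. The rejection probability is
bounded through 1 - 1/r ≤ log r.

Two foundations are needed. Differentiability of exp comes from the inverse function theorem on the
space of paths (`exists_differentiable_flow`). The geometry is tractable because the third
derivative of the potential is totally symmetric: the connection with lowered index is half of it
(`metricForm_connectionForm`), and the identities for connection and curvature are checked after
pairing with a test vector. -/

namespace GeodesicWalk

open Set Filter
open scoped Topology unitInterval ContDiff

/-! ### Differentiable dependence of solutions of an ODE on the initial value -/

section Flow

variable {Z : Type*} [NormedAddCommGroup Z]

/-- The extension of a curve on `[0, 1]` to a curve on `ℝ` that is constant on both sides. -/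
noncomputable def extendCurve (w : C(I, Z)) (s : ℝ) : Z := w (projIcc 0 1 zero_le_one s)

theorem continuous_extendCurve (w : C(I, Z)) : Continuous (extendCurve w) :=
  w.continuous.comp continuous_projIcc

theorem extendCurve_of_mem (w : C(I, Z)) {s : ℝ} (hs : s ∈ Icc (0 : ℝ) 1) :
    extendCurve w s = w ⟨s, hs⟩ := by
  rw [extendCurve, projIcc_of_mem zero_le_one hs]

theorem norm_extendCurve_le (w : C(I, Z)) (s : ℝ) : ‖extendCurve w s‖ ≤ ‖w‖ :=
  w.norm_coe_le_norm _

open Classical in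
/-- The superposition operator `z ↦ F ∘ z` (zero where `F ∘ z` is not continuous). -/
noncomputable def superposition (F : Z → Z) (z : C(I, Z)) : C(I, Z) :=
  if h : Continuous fun t => F (z t) then ⟨_, h⟩ else 0

theorem superposition_apply {F : Z → Z} {U : Set Z} (hF : ContinuousOn F U) {z : C(I, Z)}
    (hz : ∀ t, z t ∈ U) (t : I) : superposition F z t = F (z t) := by
  have h : Continuous fun t => F (z t) := hF.comp_continuous z.continuous hz
  rw [superposition, dif_pos h]
  rfl

/-- Compactness of the time interval makes the condition open in the space of paths, so nearby paths
stay in the domain of the vector field. -/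
theorem eventually_forall_mem {U : Set Z} (hU : IsOpen U) {z : C(I, Z)} (hz : ∀ t, z t ∈ U) :
    ∀ᶠ w in 𝓝 z, ∀ t, w t ∈ U := by
  have h := ContinuousMap.eventually_mapsTo (f := z) isCompact_univ hU (fun t _ => hz t)
  exact h.mono fun w hw t => hw (mem_univ t)

variable [NormedSpace ℝ Z]

/-- The operator `w ↦ (t ↦ ∫₀ᵗ w)`. -/
noncomputable def timeIntegral : C(I, Z) →L[ℝ] C(I, Z) :=
  LinearMap.mkContinuous
    { toFun := fun w => ⟨fun t => ∫ s in (0 : ℝ)..t, extendCurve w s,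
        (intervalIntegral.continuous_primitive
          (fun a b => (continuous_extendCurve w).intervalIntegrable a b) 0).comp
          continuous_subtype_val⟩
      map_add' := fun u w => by
        ext t
        exact intervalIntegral.integral_add
          ((continuous_extendCurve u).intervalIntegrable _ _)
          ((continuous_extendCurve w).intervalIntegrable _ _)
      map_smul' := fun c w => by
        ext t
        exact intervalIntegral.integral_smul c _ }
    1 (fun w => by
      rw [one_mul, ContinuousMap.norm_le _ (norm_nonneg _)]
      intro t
      refine (intervalIntegral.norm_integral_le_of_norm_le_const
        (fun s _ => norm_extendCurve_le w s)).trans ?_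
      rw [sub_zero, abs_of_nonneg t.2.1]
      exact mul_le_of_le_one_right (norm_nonneg _) t.2.2)

theorem timeIntegral_apply (w : C(I, Z)) (t : I) :
    timeIntegral w t = ∫ s in (0 : ℝ)..t, extendCurve w s := rfl

theorem hasDerivWithinAt_timeIntegral [CompleteSpace Z] (w : C(I, Z)) {t : ℝ}
    (ht : t ∈ Icc (0 : ℝ) 1) :
    HasDerivWithinAt (extendCurve (timeIntegral w)) (extendCurve w t) (Icc 0 1) t := by
  have h1 : HasDerivAt (fun r => ∫ s in (0 : ℝ)..r, extendCurve w s) (extendCurve w t) t :=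
    ((continuous_extendCurve w).integral_hasStrictDerivAt 0 t).hasDerivAt
  refine h1.hasDerivWithinAt.congr (fun r hr => ?_) ?_
  · rw [extendCurve_of_mem _ hr, timeIntegral_apply]
  · rw [extendCurve_of_mem _ ht, timeIntegral_apply]

/-- The operator `w ↦ (t ↦ A(t) w(t))`. -/
noncomputable def pointwiseApply (A : C(I, Z →L[ℝ] Z)) : C(I, Z) →L[ℝ] C(I, Z) :=
  LinearMap.mkContinuous
    { toFun := fun w => ⟨fun t => A t (w t), A.continuous.clm_apply w.continuous⟩
      map_add' := fun u w => by ext t; simp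
      map_smul' := fun c w => by ext t; simp }
    ‖A‖ (fun w => by
      rw [ContinuousMap.norm_le _ (by positivity)]
      intro t
      exact (A t).le_of_opNorm_le_of_le (A.norm_coe_le_norm t) (w.norm_coe_le_norm t))

theorem pointwiseApply_apply (A : C(I, Z →L[ℝ] Z)) (w : C(I, Z)) (t : I) :
    pointwiseApply A w t = A t (w t) := rfl

/-- Each application integrates the bound tᵐ/m! once more. The factorial is what makes a high power
of the operator a contraction, however large `A` is. -/
theorem norm_volterra_pow_apply_le (A : C(I, Z →L[ℝ] Z)) (w : C(I, Z)) (m : ℕ) (t : I) :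
    ‖((timeIntegral ∘L pointwiseApply A) ^ m) w t‖
      ≤ ‖A‖ ^ m * (t : ℝ) ^ m / m.factorial * ‖w‖ := by
  induction m generalizing t with
  | zero => simpa using w.norm_coe_le_norm t
  | succ m ih =>
    rw [pow_succ']
    set u := ((timeIntegral ∘L pointwiseApply A) ^ m) w with hu
    change ‖timeIntegral (pointwiseApply A u) t‖ ≤ _
    rw [timeIntegral_apply]
    have h1 : ∀ s ∈ Icc (0 : ℝ) t, ‖extendCurve (pointwiseApply A u) s‖
        ≤ ‖A‖ ^ (m + 1) / m.factorial * ‖w‖ * s ^ m := by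
      intro s hs
      have hs1 : s ∈ Icc (0 : ℝ) 1 := ⟨hs.1, hs.2.trans t.2.2⟩
      rw [extendCurve_of_mem _ hs1, pointwiseApply_apply]
      refine ((A _).le_of_opNorm_le_of_le (A.norm_coe_le_norm _) (ih ⟨s, hs1⟩)).trans
        (le_of_eq ?_)
      simp only
      ring
    refine (intervalIntegral.norm_integral_le_of_norm_le t.2.1
      (Filter.Eventually.of_forall fun s hs => h1 s ⟨hs.1.le, hs.2⟩)
      (Continuous.intervalIntegrable (by fun_prop) _ _)).trans (le_of_eq ?_)
    rw [intervalIntegral.integral_const_mul, integral_pow, Nat.factorial_succ]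
    push_cast
    have h2 : ((m : ℝ) + 1) ≠ 0 := by positivity
    have h3 : (m.factorial : ℝ) ≠ 0 := by positivity
    field_simp
    ring

/-- Some power K^m has norm below 1, so 1 - K^m is invertible by the Neumann series. It is the
product of 1 - K with a geometric sum commuting with it, and commuting factors of a unit are units.
-/
theorem isUnit_one_sub_volterra [CompleteSpace Z] (A : C(I, Z →L[ℝ] Z)) :
    IsUnit (1 - timeIntegral ∘L pointwiseApply A : C(I, Z) →L[ℝ] C(I, Z)) := by
  set K := (timeIntegral ∘L pointwiseApply A : C(I, Z) →L[ℝ] C(I, Z)) with hK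
  obtain ⟨m, hm⟩ := ((FloorSemiring.tendsto_pow_div_factorial_atTop ‖A‖).eventually
    (gt_mem_nhds (show (0 : ℝ) < 1 by norm_num))).exists
  have h1 : ‖K ^ m‖ ≤ ‖A‖ ^ m / m.factorial := by
    refine ContinuousLinearMap.opNorm_le_bound _ (by positivity) fun w => ?_
    rw [ContinuousMap.norm_le _ (by positivity)]
    intro t
    refine (norm_volterra_pow_apply_le A w m t).trans ?_
    gcongr
    exact mul_le_of_le_one_right (by positivity) (pow_le_one₀ t.2.1 t.2.2)
  have h2 : IsUnit (1 - K ^ m) :=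
    isUnit_one_sub_of_norm_lt_one (R := C(I, Z) →L[ℝ] C(I, Z)) (x := K ^ m) (h1.trans_lt hm)
  rw [← mul_neg_geom_sum] at h2
  have h3 : Commute (1 - K) (∑ i ∈ Finset.range m, K ^ i) :=
    (mul_neg_geom_sum K m).trans (geom_sum_mul_neg K m).symm
  exact (h3.isUnit_mul_iff.mp h2).1

/-- Near a compact set on which it is strictly differentiable with continuous derivative, a map is
uniformly close to its linearizations. -/
theorem eventually_uniform_linearization {F : Z → Z} {U k : Set Z} (hU : IsOpen U)
    (hF : ContDiffOn ℝ 1 F U) (hk : IsCompact k) (hkU : k ⊆ U) {ε : ℝ} (hε : 0 < ε) :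
    ∀ᶠ p : Z × Z in 𝓝 (0, 0), ∀ q ∈ k,
      ‖F (q + p.1) - F (q + p.2) - fderiv ℝ F q (p.1 - p.2)‖ ≤ ε * ‖p.1 - p.2‖ := by
  -- Compactness reduces the uniform statement to one near each base point, where strict
  -- differentiability and continuity of the derivative each contribute ε/2.
  refine hk.eventually_forall_of_forall_eventually (P := fun (p : Z × Z) (q : Z) =>
    ‖F (q + p.1) - F (q + p.2) - fderiv ℝ F q (p.1 - p.2)‖ ≤ ε * ‖p.1 - p.2‖) ?_
  intro q hq
  have hC : ContDiffAt ℝ 1 F q := hF.contDiffAt (hU.mem_nhds (hkU hq))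
  have h1 := (hC.hasStrictFDerivAt (by norm_num)).isLittleO.def (half_pos hε)
  have h2 : ContinuousAt (fderiv ℝ F) q :=
    (hC.fderiv_right (m := 0) (by norm_num)).continuousAt
  have h3 := h2.eventually (Metric.ball_mem_nhds _ (half_pos hε))
  have t1 : Tendsto (fun z : (Z × Z) × Z => (z.2 + z.1.1, z.2 + z.1.2)) (𝓝 ((0, 0), q))
      (𝓝 (q, q)) := by
    have : Continuous (fun z : (Z × Z) × Z => (z.2 + z.1.1, z.2 + z.1.2)) := by fun_prop
    simpa using this.tendsto ((0, 0), q)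
  have t2 : Tendsto (fun z : (Z × Z) × Z => z.2) (𝓝 ((0, 0), q)) (𝓝 q) :=
    continuous_snd.tendsto _
  filter_upwards [t1.eventually h1, t2.eventually h3] with z hz1 hz2
  have e : z.2 + z.1.1 - (z.2 + z.1.2) = z.1.1 - z.1.2 := by abel
  simp only [e] at hz1
  rw [dist_eq_norm] at hz2
  calc ‖F (z.2 + z.1.1) - F (z.2 + z.1.2) - fderiv ℝ F z.2 (z.1.1 - z.1.2)‖
      = ‖(F (z.2 + z.1.1) - F (z.2 + z.1.2) - fderiv ℝ F q (z.1.1 - z.1.2))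
          - (fderiv ℝ F z.2 - fderiv ℝ F q) (z.1.1 - z.1.2)‖ := by
        congr 1
        simp only [sub_apply]
        abel
    _ ≤ ε / 2 * ‖z.1.1 - z.1.2‖ + ε / 2 * ‖z.1.1 - z.1.2‖ := by
        refine (norm_sub_le _ _).trans (add_le_add hz1 ?_)
        exact ContinuousLinearMap.le_of_opNorm_le _ hz2.le _
    _ = ε * ‖z.1.1 - z.1.2‖ := by ring

/-- In the sup norm this is the pointwise linearization estimate of `F`, made uniform over the
compact range of `z`. -/
theorem hasStrictFDerivAt_superposition {F : Z → Z} {U : Set Z} (hU : IsOpen U)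
    (hF : ContDiffOn ℝ 1 F U) {z : C(I, Z)} (hz : ∀ t, z t ∈ U) {A : C(I, Z →L[ℝ] Z)}
    (hA : ∀ t, A t = fderiv ℝ F (z t)) :
    HasStrictFDerivAt (superposition F) (pointwiseApply A) z := by
  rw [hasStrictFDerivAt_iff_isLittleO, Asymptotics.isLittleO_iff]
  intro ε hε
  have hk : IsCompact (range z) := isCompact_range z.continuous
  have h1 := eventually_uniform_linearization hU hF hk (by rintro _ ⟨t, rfl⟩; exact hz t) hε
  rw [Metric.eventually_nhds_iff] at h1
  obtain ⟨δ, hδ, h1⟩ := h1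
  have h2 := eventually_forall_mem hU hz
  have h3 : ∀ᶠ w in 𝓝 z, ‖w - z‖ < δ := by
    filter_upwards [Metric.ball_mem_nhds z hδ] with w hw
    rwa [mem_ball_iff_norm] at hw
  filter_upwards [prod_mem_nhds (inter_mem h2 h3) (inter_mem h2 h3)] with p hp
  obtain ⟨⟨hp1, hp2⟩, hp3, hp4⟩ := hp
  rw [ContinuousMap.norm_le _ (by positivity)]
  intro t
  simp only [ContinuousMap.sub_apply, superposition_apply hF.continuousOn hp1,
    superposition_apply hF.continuousOn hp3, pointwiseApply_apply, hA]
  have h4 : ‖p.1 t - z t‖ < δ := ((p.1 - z).norm_coe_le_norm t).trans_lt hp2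
  have h5 : ‖p.2 t - z t‖ < δ := ((p.2 - z).norm_coe_le_norm t).trans_lt hp4
  have h6 := h1 (y := (p.1 t - z t, p.2 t - z t))
    (by rw [dist_eq_norm]; simpa [Prod.norm_def] using ⟨h4, h5⟩) (z t) (mem_range_self t)
  simp only [add_sub_cancel, sub_sub_sub_cancel_right] at h6
  refine h6.trans ?_
  gcongr
  exact (p.1 - p.2).norm_coe_le_norm t

/-- A solution of `z' = F(z)` on `[0, 1]` extends to a family of solutions that depends
differentiably on the initial value, with derivative given by the linearized equation. -/
theorem exists_differentiable_flow [CompleteSpace Z] {F : Z → Z} {U : Set Z} (hU : IsOpen U)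
    (hF : ContDiffOn ℝ 1 F U) {z : ℝ → Z}
    (hz : ∀ t ∈ Icc (0 : ℝ) 1, HasDerivWithinAt z (F (z t)) (Icc 0 1) t)
    (hzU : ∀ t ∈ Icc (0 : ℝ) 1, z t ∈ U) :
    ∃ (Ψ : Z → ℝ → Z) (D : ℝ → Z →L[ℝ] Z),
      (∀ᶠ a in 𝓝 (z 0), Ψ a 0 = a ∧ ∀ t ∈ Icc (0 : ℝ) 1,
        Ψ a t ∈ U ∧ HasDerivWithinAt (Ψ a) (F (Ψ a t)) (Icc 0 1) t) ∧
      (∀ t ∈ Icc (0 : ℝ) 1, HasFDerivAt (fun a => Ψ a t) (D t) (z 0)) ∧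
      ∀ b, D 0 b = b ∧ ∀ t ∈ Icc (0 : ℝ) 1,
        HasDerivWithinAt (fun s => D s b) (fderiv ℝ F (z t) (D t b)) (Icc 0 1) t := by
  have hzc : ContinuousOn z (Icc 0 1) := fun t ht => (hz t ht).continuousWithinAt
  let ζ : C(I, Z) := ⟨fun t => z t, continuousOn_iff_continuous_domRestrict.mp hzc⟩
  have hζU : ∀ t, ζ t ∈ U := fun t => hzU t t.2
  have hdF : ContinuousOn (fderiv ℝ F) U := hF.continuousOn_fderiv_of_isOpen hU le_rfl
  let A : C(I, Z →L[ℝ] Z) := ⟨fun t => fderiv ℝ F (ζ t), hdF.comp_continuous ζ.continuous hζU⟩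
  have hN := hasStrictFDerivAt_superposition hU hF hζU (A := A) (fun t => rfl)
  obtain ⟨u, hu⟩ := isUnit_one_sub_volterra A
  let e : C(I, Z) ≃L[ℝ] C(I, Z) := ContinuousLinearEquiv.ofUnit u
  have he : ∀ w, e w = w - timeIntegral (pointwiseApply A w) := by
    intro w
    change (u : C(I, Z) →L[ℝ] C(I, Z)) w = _
    rw [hu]
    rfl
  -- For paths in `U`, `P w` is the constant path `a` exactly when `w` solves the equation with
  -- initial value `a`. The flow is the local inverse of `P` restricted to constant paths; since the
  -- paths already live on all of [0, 1], no continuation in time is needed.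
  let P : C(I, Z) → C(I, Z) := fun w => w - timeIntegral (superposition F w)
  have hP : HasStrictFDerivAt P (e : C(I, Z) →L[ℝ] C(I, Z)) ζ := by
    have h := (hasStrictFDerivAt_id ζ).sub
      ((timeIntegral (Z := Z)).hasStrictFDerivAt.comp ζ hN)
    refine h.congr_fderiv ?_
    ext1 w
    exact (he w).symm
  let κ : Z →L[ℝ] C(I, Z) := LinearMap.mkContinuous
    { toFun := fun a => ContinuousMap.const I a
      map_add' := fun a b => rfl
      map_smul' := fun c a => rfl } 1 (fun a => by
        rw [one_mul, ContinuousMap.norm_le _ (norm_nonneg _)]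
        exact fun t => le_rfl)
  have hPζ : P ζ = κ (z 0) := by
    ext t
    change z t - timeIntegral (superposition F ζ) t = z 0
    rw [timeIntegral_apply]
    have h1 : ∫ s in (0 : ℝ)..t, extendCurve (superposition F ζ) s = z t - z 0 := by
      have hsub : Icc (0 : ℝ) t ⊆ Icc 0 1 := Icc_subset_Icc_right t.2.2
      refine intervalIntegral.integral_eq_sub_of_hasDeriv_right_of_le t.2.1 (hzc.mono hsub)
        (fun s hs => ?_) ((continuous_extendCurve _).intervalIntegrable _ _)
      have hs1 : s ∈ Ioo (0 : ℝ) 1 := ⟨hs.1, hs.2.trans_le t.2.2⟩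
      have hs2 := Ioo_subset_Icc_self hs1
      rw [extendCurve_of_mem _ hs2, superposition_apply hF.continuousOn hζU]
      exact ((hz s hs2).hasDerivAt (Icc_mem_nhds hs1.1 hs1.2)).hasDerivWithinAt
    rw [h1]
    abel
  let S := hP.localInverse P e ζ
  have hS0 : S (κ (z 0)) = ζ := by
    rw [← hPζ]
    exact hP.localInverse_apply_image
  have hSd : HasFDerivAt (fun a => S (κ a)) ((e.symm : C(I, Z) →L[ℝ] C(I, Z)) ∘L κ) (z 0) := by
    have h := hP.to_localInverse.hasFDerivAt
    rw [hPζ] at h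
    exact h.comp (z 0) κ.hasFDerivAt
  have hSc : Tendsto (fun a => S (κ a)) (𝓝 (z 0)) (𝓝 ζ) := by
    have h := hSd.continuousAt.tendsto
    rwa [hS0] at h
  have hSr : ∀ᶠ a in 𝓝 (z 0), P (S (κ a)) = κ a := by
    have h := hP.eventually_right_inverse
    rw [hPζ] at h
    exact κ.continuous.continuousAt.eventually h
  have hSU : ∀ᶠ a in 𝓝 (z 0), ∀ t, S (κ a) t ∈ U := hSc.eventually (eventually_forall_mem hU hζU)
  let ev : I → C(I, Z) →L[ℝ] Z := fun t => ContinuousMap.evalCLM ℝ t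
  refine ⟨fun a => extendCurve (S (κ a)), fun t =>
    ev (projIcc 0 1 zero_le_one t) ∘L ((e.symm : C(I, Z) →L[ℝ] C(I, Z)) ∘L κ), ?_, ?_, ?_⟩
  · filter_upwards [hSr, hSU] with a ha haU
    have h1 : ∀ t, S (κ a) t = a + timeIntegral (superposition F (S (κ a))) t := by
      intro t
      have := DFunLike.congr_fun ha t
      change S (κ a) t - timeIntegral (superposition F (S (κ a))) t = a at this
      exact (sub_eq_iff_eq_add.mp this)
    constructor
    · rw [extendCurve_of_mem _ ⟨le_rfl, zero_le_one⟩, h1, timeIntegral_apply]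
      simp
    · intro t ht
      have h2 : HasDerivWithinAt (extendCurve (S (κ a)))
          (extendCurve (superposition F (S (κ a))) t) (Icc 0 1) t :=
        ((hasDerivWithinAt_timeIntegral _ ht).const_add a).congr (fun s _ => h1 _) (h1 _)
      refine ⟨haU _, ?_⟩
      rw [extendCurve_of_mem _ ht, superposition_apply hF.continuousOn haU] at h2
      rw [extendCurve_of_mem _ ht]
      exact h2
  · intro t _
    exact (ev (projIcc 0 1 zero_le_one t)).hasFDerivAt.comp (z 0) hSd
  · intro b
    set w := e.symm (κ b) with hw
    have h1 : ∀ t, w t = b + timeIntegral (pointwiseApply A w) t := by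
      intro t
      have h := he w
      rw [hw, e.apply_symm_apply, ← hw] at h
      have := DFunLike.congr_fun h t
      change b = w t - timeIntegral (pointwiseApply A w) t at this
      rw [this]
      abel
    change extendCurve w 0 = b ∧ ∀ t ∈ Icc (0 : ℝ) 1,
      HasDerivWithinAt (extendCurve w) (fderiv ℝ F (z t) (extendCurve w t)) (Icc 0 1) t
    constructor
    · rw [extendCurve_of_mem _ ⟨le_rfl, zero_le_one⟩, h1, timeIntegral_apply]
      simp
    · intro t ht
      have h2 : HasDerivWithinAt (extendCurve w)
          (extendCurve (pointwiseApply A w) t) (Icc 0 1) t :=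
        ((hasDerivWithinAt_timeIntegral _ ht).const_add b).congr (fun s _ => h1 _) (h1 _)
      rw [extendCurve_of_mem _ ht, pointwiseApply_apply] at h2
      rw [extendCurve_of_mem _ ht]
      exact h2

/-- Solutions of `z' = F(z)` on `[0, T]` with the same initial value agree. -/
theorem eqOn_of_hasDerivWithinAt {F : Z → Z} {U : Set Z} (hU : IsOpen U)
    (hF : ContDiffOn ℝ 1 F U) {T : ℝ} {z w : ℝ → Z}
    (hz : ∀ t ∈ Icc 0 T, HasDerivWithinAt z (F (z t)) (Icc 0 T) t)
    (hzU : ∀ t ∈ Icc 0 T, z t ∈ U)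
    (hw : ∀ t ∈ Icc 0 T, HasDerivWithinAt w (F (w t)) (Icc 0 T) t)
    (hwU : ∀ t ∈ Icc 0 T, w t ∈ U) (h0 : z 0 = w 0) : EqOn z w (Icc 0 T) := by
  have hzc : ContinuousOn z (Icc 0 T) := fun t ht => (hz t ht).continuousWithinAt
  have hwc : ContinuousOn w (Icc 0 T) := fun t ht => (hw t ht).continuousWithinAt
  -- A C¹ field is only locally Lipschitz; on the compact union of the two trajectories it has one
  -- Lipschitz constant, as Grönwall uniqueness requires.
  set k := z '' Icc 0 T ∪ w '' Icc 0 T with hk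
  have hkc : IsCompact k :=
    (isCompact_Icc.image_of_continuousOn hzc).union (isCompact_Icc.image_of_continuousOn hwc)
  have hkU : k ⊆ U := by
    rintro _ (⟨t, ht, rfl⟩ | ⟨t, ht, rfl⟩)
    exacts [hzU t ht, hwU t ht]
  have hL : LocallyLipschitzOn k F := by
    intro q hq
    obtain ⟨K, t, ht, hKt⟩ := (hF.contDiffAt (hU.mem_nhds (hkU hq))).exists_lipschitzOnWith
    exact ⟨K, t, mem_nhdsWithin_of_mem_nhds ht, hKt⟩
  obtain ⟨K, hK⟩ := hL.exists_lipschitzOnWith_of_compact hkc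
  have hd : ∀ y : ℝ → Z, (∀ t ∈ Icc 0 T, HasDerivWithinAt y (F (y t)) (Icc 0 T) t) →
      ∀ t ∈ Ico 0 T, HasDerivWithinAt y (F (y t)) (Ici t) t := fun y hy t ht =>
    (hy t (Ico_subset_Icc_self ht)).mono_of_mem_nhdsWithin (Icc_mem_nhdsGE_of_mem ht)
  exact ODE_solution_unique_of_mem_Icc_right (v := fun _ => F) (s := fun _ => k)
    (fun _ _ => hK) hzc (hd z hz)
    (fun t ht => Or.inl (mem_image_of_mem z (Ico_subset_Icc_self ht))) hwc (hd w hw)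
    (fun t ht => Or.inr (mem_image_of_mem w (Ico_subset_Icc_self ht))) h0

end Flow

end GeodesicWalk

namespace GeodesicWalk

open Set Filter
open scoped Topology ContDiff Matrix

/-! ### Derivatives of determinants and inverses of matrices -/

section MatrixCalculus

variable {X : Type*} [NormedAddCommGroup X] [NormedSpace ℝ X] {m : Type*} [Fintype m]
  [DecidableEq m]

theorem contDiffAt_det {A : X → Matrix m m ℝ} {x : X} {r : WithTop ℕ∞}
    (hA : ∀ i j, ContDiffAt ℝ r (fun z => A z i j) x) : ContDiffAt ℝ r (fun z => (A z).det) x := by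
  simp only [Matrix.det_apply']
  exact ContDiffAt.sum fun σ _ =>
    contDiffAt_const.mul (contDiffAt_prod fun i _ => hA (σ i) i)

theorem contDiffAt_inv_apply {A : X → Matrix m m ℝ} {x : X} {r : WithTop ℕ∞}
    (hA : ∀ i j, ContDiffAt ℝ r (fun z => A z i j) x) (hx : (A x).det ≠ 0) (i j : m) :
    ContDiffAt ℝ r (fun z => (A z)⁻¹ i j) x := by
  simp only [Matrix.inv_def, Ring.inverse_eq_inv', Matrix.smul_apply, smul_eq_mul,
    Matrix.adjugate_apply]
  refine ((contDiffAt_det hA).inv hx).mul (contDiffAt_det fun a b => ?_)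
  by_cases h : a = j
  · subst h
    simpa using contDiffAt_const
  · simpa [Matrix.updateRow_ne h] using hA a b

/-- Jacobi's formula for the derivative of a determinant. -/
theorem hasFDerivAt_det {A : X → Matrix m m ℝ} {x : X} {A' : m → m → X →L[ℝ] ℝ}
    (hA : ∀ i j, HasFDerivAt (fun z => A z i j) (A' i j) x) :
    HasFDerivAt (fun z => (A z).det) (∑ i, ∑ j, (A x).adjugate j i • A' i j) x := by
  have h1 : HasFDerivAt (fun z => (A z).det) (∑ σ : Equiv.Perm m, ((Equiv.Perm.sign σ : ℤ) : ℝ) •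
      ∑ i, (∏ j ∈ Finset.univ.erase i, A x (σ j) j) • A' (σ i) i) x := by
    simp only [Matrix.det_apply']
    exact HasFDerivAt.fun_sum fun σ _ =>
      (HasFDerivAt.finsetProd fun i _ => hA (σ i) i).const_mul _
  refine h1.congr_fderiv ?_
  ext w
  -- By Cramer's rule both sides are the determinant of `A x` with column `j` replaced by its
  -- derivative.
  have h2 : ∀ j, ∑ i, (A x).adjugate j i * A' i j w
      = ∑ σ : Equiv.Perm m, ((Equiv.Perm.sign σ : ℤ) : ℝ) *
        ((∏ i ∈ Finset.univ.erase j, A x (σ i) i) * A' (σ j) j w) := by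
    intro j
    have h3 : ∑ i, (A x).adjugate j i * A' i j w
        = ((A x).updateCol j fun i => A' i j w).det := by
      rw [← Matrix.cramer_apply, Matrix.cramer_eq_adjugate_mulVec]
      rfl
    rw [h3, Matrix.det_apply']
    refine Finset.sum_congr rfl fun σ _ => ?_
    rw [← Finset.prod_erase_mul _ _ (Finset.mem_univ j), Matrix.updateCol_self]
    congr 2
    refine Finset.prod_congr rfl fun i hi => ?_
    rw [Matrix.updateCol_ne (Finset.ne_of_mem_erase hi)]
  simp only [sum_apply, smul_apply, smul_eq_mul, Finset.mul_sum]
  rw [Finset.sum_comm]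
  refine Eq.trans ?_ Finset.sum_comm
  exact Finset.sum_congr rfl fun j _ => (h2 j).symm

end MatrixCalculus

/-! ### The derivatives of the metric as multilinear forms -/

theorem minSmoothness_two_le : minSmoothness ℝ 2 ≤ (∞ : WithTop ℕ∞) := by
  rw [minSmoothness_of_isRCLikeNormedField]
  exact WithTop.coe_le_coe.mpr le_top

theorem apply_eq_sum_single {n : ℕ} {F : Type*} [NormedAddCommGroup F] [NormedSpace ℝ F]
    (L : (Fin n → ℝ) →L[ℝ] F) (u : Fin n → ℝ) : L u = ∑ i, u i • L (Pi.single i 1) := by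
  conv_lhs => rw [← Finset.univ_sum_single u]
  rw [map_sum]
  refine Finset.sum_congr rfl fun i _ => ?_
  rw [← map_smul, ← Pi.single_smul, smul_eq_mul, mul_one]

theorem apply_eq_sum_pderiv {n : ℕ} (f : (Fin n → ℝ) → ℝ) (x u : Fin n → ℝ) :
    fderiv ℝ f x u = ∑ i, u i * pderiv i f x :=
  apply_eq_sum_single _ u

section Forms

set_option synthInstance.maxHeartbeats 200000
set_option maxSynthPendingDepth 3

variable {n : ℕ} (M : HessianManifold n)

/-- The metric as a bilinear form: the second derivative of the potential. -/
noncomputable def metricForm (x : Fin n → ℝ) : (Fin n → ℝ) →L[ℝ] (Fin n → ℝ) →L[ℝ] ℝ :=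
  fderiv ℝ (fderiv ℝ M.potential) x

/-- The third derivative of the potential. -/
noncomputable def cubicForm (x : Fin n → ℝ) :
    (Fin n → ℝ) →L[ℝ] (Fin n → ℝ) →L[ℝ] (Fin n → ℝ) →L[ℝ] ℝ :=
  fderiv ℝ (metricForm M) x

/-- The fourth derivative of the potential. -/
noncomputable def quarticForm (x : Fin n → ℝ) :
    (Fin n → ℝ) →L[ℝ] (Fin n → ℝ) →L[ℝ] (Fin n → ℝ) →L[ℝ] (Fin n → ℝ) →L[ℝ] ℝ :=
  fderiv ℝ (cubicForm M) x

variable {M} {x : Fin n → ℝ}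

theorem contDiffAt_potential (hx : x ∈ M.carrier) : ContDiffAt ℝ ∞ M.potential x :=
  M.smooth.contDiffAt (M.isOpen.mem_nhds hx)

theorem contDiffAt_fderiv_potential (hx : x ∈ M.carrier) :
    ContDiffAt ℝ ∞ (fderiv ℝ M.potential) x :=
  (contDiffAt_potential hx).fderiv_right (m := ∞) (by simp)

theorem contDiffAt_metricForm (hx : x ∈ M.carrier) : ContDiffAt ℝ ∞ (metricForm M) x :=
  (contDiffAt_fderiv_potential hx).fderiv_right (m := ∞) (by simp)

theorem contDiffAt_cubicForm (hx : x ∈ M.carrier) : ContDiffAt ℝ ∞ (cubicForm M) x :=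
  (contDiffAt_metricForm hx).fderiv_right (m := ∞) (by simp)

theorem hasFDerivAt_metricForm (hx : x ∈ M.carrier) :
    HasFDerivAt (metricForm M) (cubicForm M x) x :=
  ((contDiffAt_metricForm hx).differentiableAt (by simp)).hasFDerivAt

theorem hasFDerivAt_cubicForm (hx : x ∈ M.carrier) :
    HasFDerivAt (cubicForm M) (quarticForm M x) x :=
  ((contDiffAt_cubicForm hx).differentiableAt (by simp)).hasFDerivAt

theorem metricForm_comm (hx : x ∈ M.carrier) (u v : Fin n → ℝ) :
    metricForm M x u v = metricForm M x v u :=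
  (contDiffAt_potential hx).isSymmSndFDerivAt minSmoothness_two_le u v

theorem cubicForm_comm (hx : x ∈ M.carrier) (u v w : Fin n → ℝ) :
    cubicForm M x u v w = cubicForm M x v u w := by
  have h := (contDiffAt_fderiv_potential hx).isSymmSndFDerivAt minSmoothness_two_le
  exact DFunLike.congr_fun (h u v) w

/-- Obtained by differentiating the symmetry of the metric. With `cubicForm_comm` it gives total
symmetry, the property that singles out Hessian metrics. -/
theorem cubicForm_comm' (hx : x ∈ M.carrier) (u v w : Fin n → ℝ) :
    cubicForm M x u v w = cubicForm M x u w v := by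
  have h1 : HasFDerivAt (fun z => metricForm M z v w) _ x :=
    ((hasFDerivAt_metricForm hx).clm_apply (hasFDerivAt_const v x)).clm_apply
      (hasFDerivAt_const w x)
  have h2 : HasFDerivAt (fun z => metricForm M z w v) _ x :=
    ((hasFDerivAt_metricForm hx).clm_apply (hasFDerivAt_const w x)).clm_apply
      (hasFDerivAt_const v x)
  have h3 : (fun z => metricForm M z v w) =ᶠ[𝓝 x] fun z => metricForm M z w v := by
    filter_upwards [M.isOpen.mem_nhds hx] with z hz using metricForm_comm hz v w
  simpa using DFunLike.congr_fun (h1.unique (h2.congr_of_eventuallyEq h3)) u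

theorem quarticForm_comm (hx : x ∈ M.carrier) (a b u v : Fin n → ℝ) :
    quarticForm M x a b u v = quarticForm M x b a u v := by
  have h := (contDiffAt_metricForm hx).isSymmSndFDerivAt minSmoothness_two_le
  exact DFunLike.congr_fun (DFunLike.congr_fun (h a b) u) v

theorem quarticForm_comm' (hx : x ∈ M.carrier) (a b u v : Fin n → ℝ) :
    quarticForm M x a b u v = quarticForm M x a u b v := by
  have h1 (b u : Fin n → ℝ) : HasFDerivAt (fun z => cubicForm M z b u v) _ x :=
    (((hasFDerivAt_cubicForm hx).clm_apply (hasFDerivAt_const b x)).clm_apply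
      (hasFDerivAt_const u x)).clm_apply (hasFDerivAt_const v x)
  have h3 : (fun z => cubicForm M z b u v) =ᶠ[𝓝 x] fun z => cubicForm M z u b v := by
    filter_upwards [M.isOpen.mem_nhds hx] with z hz using cubicForm_comm hz b u v
  simpa using DFunLike.congr_fun ((h1 b u).unique ((h1 u b).congr_of_eventuallyEq h3)) a

theorem metric_apply (hx : x ∈ M.carrier) (i j : Fin n) :
    metric M x i j = metricForm M x (Pi.single i 1) (Pi.single j 1) := by
  have h1 : HasFDerivAt (fun z => fderiv ℝ M.potential z (Pi.single j 1)) _ x :=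
    (((contDiffAt_fderiv_potential hx).differentiableAt (by simp)).hasFDerivAt).clm_apply
      (hasFDerivAt_const (Pi.single j 1) x)
  change fderiv ℝ (fun z => fderiv ℝ M.potential z (Pi.single j 1)) x (Pi.single i 1) = _
  rw [h1.fderiv]
  simp [metricForm]

theorem metricInner_eq (hx : x ∈ M.carrier) (u v : Fin n → ℝ) :
    metricInner M x u v = metricForm M x u v := by
  rw [apply_eq_sum_single (metricForm M x) u]
  simp only [sum_apply, smul_apply, smul_eq_mul, metricInner, dotProduct, Matrix.mulVec]
  refine Finset.sum_congr rfl fun i _ => ?_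
  rw [apply_eq_sum_single _ v]
  congr 1
  refine Finset.sum_congr rfl fun j _ => ?_
  rw [metric_apply hx, smul_eq_mul, mul_comm]

theorem hasFDerivAt_metric (hx : x ∈ M.carrier) (i j : Fin n) :
    HasFDerivAt (fun z => metric M z i j)
      (((cubicForm M x).flip (Pi.single i 1)).flip (Pi.single j 1)) x := by
  have h1 : HasFDerivAt (fun z => metricForm M z (Pi.single i 1) (Pi.single j 1)) _ x :=
    ((hasFDerivAt_metricForm hx).clm_apply (hasFDerivAt_const (Pi.single i 1) x)).clm_apply
      (hasFDerivAt_const (Pi.single j 1) x)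
  have h2 : (fun z => metric M z i j) =ᶠ[𝓝 x]
      fun z => metricForm M z (Pi.single i 1) (Pi.single j 1) := by
    filter_upwards [M.isOpen.mem_nhds hx] with z hz using metric_apply hz i j
  refine (h1.congr_of_eventuallyEq h2).congr_fderiv ?_
  ext w
  simp

theorem pderiv_metric (hx : x ∈ M.carrier) (k i j : Fin n) :
    pderiv k (fun z => metric M z i j) x
      = cubicForm M x (Pi.single k 1) (Pi.single i 1) (Pi.single j 1) := by
  rw [pderiv, (hasFDerivAt_metric hx i j).fderiv]
  simp

theorem contDiffAt_metric (hx : x ∈ M.carrier) (i j : Fin n) :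
    ContDiffAt ℝ ∞ (fun z => metric M z i j) x := by
  have h2 : (fun z => metric M z i j) =ᶠ[𝓝 x]
      fun z => metricForm M z (Pi.single i 1) (Pi.single j 1) := by
    filter_upwards [M.isOpen.mem_nhds hx] with z hz using metric_apply hz i j
  exact (((contDiffAt_metricForm hx).clm_apply contDiffAt_const).clm_apply
    contDiffAt_const).congr_of_eventuallyEq h2

theorem contDiffAt_pderiv {f : (Fin n → ℝ) → ℝ} (hf : ContDiffAt ℝ ∞ f x) (i : Fin n) :
    ContDiffAt ℝ ∞ (pderiv i f) x :=
  (hf.fderiv_right (m := ∞) (by simp)).clm_apply contDiffAt_const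

theorem posDef_metric (hx : x ∈ M.carrier) : (metric M x).PosDef := M.posDef x hx

theorem isSymm_metric (hx : x ∈ M.carrier) : (metric M x).IsSymm :=
  (posDef_metric hx).isHermitian

theorem det_metric_pos (hx : x ∈ M.carrier) : 0 < (metric M x).det := (posDef_metric hx).det_pos

theorem metric_mul_inv (hx : x ∈ M.carrier) : metric M x * (metric M x)⁻¹ = 1 :=
  Matrix.mul_nonsing_inv _ (det_metric_pos hx).ne'.isUnit

theorem metric_inv_symm (hx : x ∈ M.carrier) (i j : Fin n) :
    (metric M x)⁻¹ i j = (metric M x)⁻¹ j i := by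
  have h : ((metric M x)⁻¹)ᵀ = (metric M x)⁻¹ := by
    rw [Matrix.transpose_nonsing_inv, (isSymm_metric hx).eq]
  exact congr_fun (congr_fun h.symm i) j

theorem metricForm_self_pos (hx : x ∈ M.carrier) {u : Fin n → ℝ} (hu : u ≠ 0) :
    0 < metricForm M x u u := by
  rw [← metricInner_eq hx]
  have h := (Matrix.posDef_iff_dotProduct_mulVec.mp (posDef_metric hx)).2 hu
  exact h

theorem metricForm_self_nonneg (hx : x ∈ M.carrier) (u : Fin n → ℝ) :
    0 ≤ metricForm M x u u := by
  by_cases hu : u = 0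
  · simp [hu]
  · exact (metricForm_self_pos hx hu).le

theorem metricNorm_sq (hx : x ∈ M.carrier) (u : Fin n → ℝ) :
    metricNorm M x u ^ 2 = metricForm M x u u := by
  rw [metricNorm, metricInner_eq hx, Real.sq_sqrt (metricForm_self_nonneg hx u)]

theorem metricForm_eq_dotProduct (hx : x ∈ M.carrier) (u v : Fin n → ℝ) :
    metricForm M x u v = u ⬝ᵥ (metric M x *ᵥ v) := (metricInner_eq hx u v).symm

/-- Nondegeneracy: vector identities may be verified after lowering an index. -/
theorem eq_of_metricForm_eq (hx : x ∈ M.carrier) {u v : Fin n → ℝ}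
    (h : ∀ w, metricForm M x u w = metricForm M x v w) : u = v := by
  by_contra hne
  have h1 := metricForm_self_pos hx (sub_ne_zero.mpr hne)
  have h2 : metricForm M x (u - v) (u - v) = 0 := by
    rw [map_sub (metricForm M x), sub_apply, h, sub_self]
  rw [h2] at h1
  exact lt_irrefl _ h1

theorem metricForm_inv_mulVec (hx : x ∈ M.carrier) (t c : Fin n → ℝ) :
    metricForm M x ((metric M x)⁻¹ *ᵥ t) c = t ⬝ᵥ c := by
  rw [metricForm_comm hx, metricForm_eq_dotProduct hx, Matrix.mulVec_mulVec, metric_mul_inv hx,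
    Matrix.one_mulVec, dotProduct_comm]

end Forms

end GeodesicWalk

namespace GeodesicWalk

open Set Filter
open scoped Topology ContDiff Matrix

/-! ### The Levi-Civita connection, curvature and drift -/

section Connection

set_option synthInstance.maxHeartbeats 200000
set_option maxSynthPendingDepth 3

variable {n : ℕ} (M : HessianManifold n)

/-- The contraction `Γᵏᵢⱼ aᵢ bⱼ` of the Christoffel symbols with two vectors. -/
noncomputable def connectionForm (x a b : Fin n → ℝ) : Fin n → ℝ :=
  fun k => ∑ i, ∑ j, christoffel M x k i j * a i * b j

/-- The geodesic vector field `(x, v) ↦ (v, -Γ(v, v))` on the tangent bundle. -/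
noncomputable def geodesicField (z : (Fin n → ℝ) × (Fin n → ℝ)) : (Fin n → ℝ) × (Fin n → ℝ) :=
  (z.2, -connectionForm M z.1 z.2 z.2)

variable {M} {x : Fin n → ℝ}

/-- By total symmetry the three derivatives of the metric coincide, and two of them cancel. -/
theorem christoffel_eq (hx : x ∈ M.carrier) (k i j : Fin n) :
    christoffel M x k i j = (1 / 2) * ∑ l, (metric M x)⁻¹ k l *
      cubicForm M x (Pi.single i 1) (Pi.single j 1) (Pi.single l 1) := by
  rw [christoffel]
  congr 1
  refine Finset.sum_congr rfl fun l _ => ?_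
  rw [pderiv_metric hx, pderiv_metric hx, pderiv_metric hx,
    cubicForm_comm hx (Pi.single j 1) (Pi.single i 1),
    cubicForm_comm hx (Pi.single l 1), cubicForm_comm' hx _ (Pi.single l 1)]
  ring

theorem connectionForm_eq (hx : x ∈ M.carrier) (a b : Fin n → ℝ) :
    connectionForm M x a b
      = (1 / 2 : ℝ) • ((metric M x)⁻¹ *ᵥ fun l => cubicForm M x a b (Pi.single l 1)) := by
  have h : ∀ l, cubicForm M x a b (Pi.single l 1) = ∑ i, ∑ j, a i * b j *
      cubicForm M x (Pi.single i 1) (Pi.single j 1) (Pi.single l 1) := by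
    intro l
    rw [apply_eq_sum_single (cubicForm M x) a]
    simp only [sum_apply, smul_apply, smul_eq_mul]
    refine Finset.sum_congr rfl fun i _ => ?_
    rw [apply_eq_sum_single (cubicForm M x (Pi.single i 1)) b]
    simp only [sum_apply, smul_apply, smul_eq_mul, Finset.mul_sum, mul_assoc]
  ext k
  simp only [connectionForm, christoffel_eq hx, Pi.smul_apply, Matrix.mulVec, dotProduct, h,
    Finset.mul_sum, Finset.sum_mul, smul_eq_mul]
  symm
  rw [Finset.sum_comm]
  refine Finset.sum_congr rfl fun i _ => ?_
  rw [Finset.sum_comm]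
  refine Finset.sum_congr rfl fun j _ => Finset.sum_congr rfl fun l _ => ?_
  ring

theorem metricForm_connectionForm (hx : x ∈ M.carrier) (a b c : Fin n → ℝ) :
    metricForm M x (connectionForm M x a b) c = (1 / 2) * cubicForm M x a b c := by
  rw [connectionForm_eq hx, map_smul, smul_apply, metricForm_inv_mulVec hx, smul_eq_mul,
    apply_eq_sum_single (cubicForm M x a b) c]
  simp only [dotProduct, smul_eq_mul, mul_comm]

theorem contDiffAt_metric_inv (hx : x ∈ M.carrier) (i j : Fin n) :
    ContDiffAt ℝ ∞ (fun z => (metric M z)⁻¹ i j) x :=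
  contDiffAt_inv_apply (contDiffAt_metric hx) (det_metric_pos hx).ne' i j

theorem contDiffAt_christoffel (hx : x ∈ M.carrier) (k i j : Fin n) :
    ContDiffAt ℝ ∞ (fun z => christoffel M z k i j) x := by
  unfold christoffel
  refine contDiffAt_const.mul (ContDiffAt.sum fun l _ => (contDiffAt_metric_inv hx k l).mul ?_)
  exact ((contDiffAt_pderiv (contDiffAt_metric hx j l) i).add
    (contDiffAt_pderiv (contDiffAt_metric hx i l) j)).sub
    (contDiffAt_pderiv (contDiffAt_metric hx i j) l)

theorem contDiffAt_geodesicField {z : (Fin n → ℝ) × (Fin n → ℝ)} (hz : z.1 ∈ M.carrier) :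
    ContDiffAt ℝ ∞ (geodesicField M) z := by
  unfold geodesicField connectionForm
  refine contDiffAt_snd.prodMk (ContDiffAt.neg (contDiffAt_pi.mpr fun k => ?_))
  have h2 (i : Fin n) : ContDiffAt ℝ ∞ (fun z : (Fin n → ℝ) × (Fin n → ℝ) => z.2 i) z :=
    (contDiffAt_pi.mp contDiffAt_snd) i
  refine ContDiffAt.sum fun i _ => ContDiffAt.sum fun j _ => (ContDiffAt.mul ?_ (h2 i)).mul (h2 j)
  exact (contDiffAt_christoffel hz k i j).comp z contDiffAt_fst

theorem contDiffOn_geodesicField :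
    ContDiffOn ℝ ∞ (geodesicField M) (M.carrier ×ˢ univ) :=
  fun _ hz => (contDiffAt_geodesicField hz.1).contDiffWithinAt

theorem isOpen_phaseSpace : IsOpen (M.carrier ×ˢ (univ : Set (Fin n → ℝ))) :=
  M.isOpen.prod isOpen_univ

theorem metricForm_accel (hx : x ∈ M.carrier) (v u : Fin n → ℝ) :
    metricForm M x (geodesicField M (x, v)).2 u = -(1 / 2) * cubicForm M x v v u := by
  simp only [geodesicField]
  rw [map_neg, neg_apply, metricForm_connectionForm hx]
  ring

theorem fderiv_geodesicField_fst (hx : x ∈ M.carrier) (v J K : Fin n → ℝ) :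
    (fderiv ℝ (geodesicField M) (x, v) (J, K)).1 = K := by
  have h := ((contDiffAt_geodesicField (M := M) (z := (x, v)) hx).differentiableAt
    (by simp)).hasFDerivAt
  have h1 : HasFDerivAt (fun z => (geodesicField M z).1) _ (x, v) :=
    (ContinuousLinearMap.fst ℝ (Fin n → ℝ) (Fin n → ℝ)).hasFDerivAt.comp (x, v) h
  have h2 : HasFDerivAt (fun z => (geodesicField M z).1)
      (ContinuousLinearMap.snd ℝ (Fin n → ℝ) (Fin n → ℝ)) (x, v) := hasFDerivAt_snd
  simpa using DFunLike.congr_fun (h1.unique h2) (J, K)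

/-- Found by differentiating the lowered identity `metricForm_accel`, which contains no inverse
metric. The right side is the lowered Jacobi equation. -/
theorem metricForm_fderiv_geodesicField_snd (hx : x ∈ M.carrier) (v J K u : Fin n → ℝ) :
    metricForm M x (fderiv ℝ (geodesicField M) (x, v) (J, K)).2 u
      = -(1 / 2) * quarticForm M x J v v u - cubicForm M x v K u
        - cubicForm M x J (geodesicField M (x, v)).2 u := by
  have h := ((contDiffAt_geodesicField (M := M) (z := (x, v)) hx).differentiableAt
    (by simp)).hasFDerivAt
  have h1 : HasFDerivAt (fun z => (geodesicField M z).2) _ (x, v) :=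
    (ContinuousLinearMap.snd ℝ (Fin n → ℝ) (Fin n → ℝ)).hasFDerivAt.comp (x, v) h
  have hG : HasFDerivAt (fun z : (Fin n → ℝ) × (Fin n → ℝ) => metricForm M z.1) _ (x, v) :=
    (hasFDerivAt_metricForm hx).comp (x, v) hasFDerivAt_fst
  have hT : HasFDerivAt (fun z : (Fin n → ℝ) × (Fin n → ℝ) => cubicForm M z.1) _ (x, v) :=
    (hasFDerivAt_cubicForm hx).comp (x, v) hasFDerivAt_fst
  have hl := (hG.clm_apply h1).clm_apply (hasFDerivAt_const u (x, v))
  have hr := (((hT.clm_apply hasFDerivAt_snd).clm_apply hasFDerivAt_snd).clm_apply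
    (hasFDerivAt_const u (x, v))).const_mul (-(1 / 2))
  have he : (fun z : (Fin n → ℝ) × (Fin n → ℝ) => metricForm M z.1 (geodesicField M z).2 u)
      =ᶠ[𝓝 (x, v)] fun z => -(1 / 2) * cubicForm M z.1 z.2 z.2 u := by
    filter_upwards [isOpen_phaseSpace.mem_nhds (show (x, v) ∈ M.carrier ×ˢ univ from ⟨hx, trivial⟩)]
      with z hz using metricForm_accel hz.1 z.2 u
  have := DFunLike.congr_fun (hl.unique (hr.congr_of_eventuallyEq he)) (J, K)
  simp at this
  rw [cubicForm_comm hx K v u] at this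
  linarith

theorem hasFDerivAt_connectionForm (hx : x ∈ M.carrier) (a b : Fin n → ℝ) :
    HasFDerivAt (fun z => connectionForm M z a b) (ContinuousLinearMap.pi fun k =>
      ∑ i, ∑ j, (a i * b j) • fderiv ℝ (fun z => christoffel M z k i j) x) x := by
  refine hasFDerivAt_pi.mpr fun k => ?_
  unfold connectionForm
  refine HasFDerivAt.fun_sum fun i _ => HasFDerivAt.fun_sum fun j _ => ?_
  have h := ((contDiffAt_christoffel hx k i j).differentiableAt (by simp)).hasFDerivAt
  refine (h.const_mul (a i * b j)).congr_of_eventuallyEq (Eventually.of_forall fun z => ?_)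
  simp only
  ring

theorem fderiv_connectionForm_apply (hx : x ∈ M.carrier) (a b u : Fin n → ℝ) (k : Fin n) :
    fderiv ℝ (fun z => connectionForm M z a b) x u k
      = ∑ l, ∑ i, ∑ j, pderiv l (fun z => christoffel M z k i j) x * u l * a i * b j := by
  rw [(hasFDerivAt_connectionForm hx a b).fderiv]
  simp only [ContinuousLinearMap.coe_pi', sum_apply, smul_apply, smul_eq_mul,
    apply_eq_sum_pderiv, Finset.mul_sum]
  symm
  rw [Finset.sum_comm]
  refine Finset.sum_congr rfl fun i _ => ?_
  rw [Finset.sum_comm]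
  refine Finset.sum_congr rfl fun j _ => Finset.sum_congr rfl fun l _ => ?_
  ring

/-- Again the lowered identity is differentiated, so the derivative of g⁻¹ never appears. -/
theorem metricForm_fderiv_connectionForm (hx : x ∈ M.carrier) (a b c u : Fin n → ℝ) :
    metricForm M x (fderiv ℝ (fun z => connectionForm M z a b) x u) c
      = (1 / 2) * quarticForm M x u a b c - cubicForm M x u (connectionForm M x a b) c := by
  have h := (hasFDerivAt_connectionForm hx a b).differentiableAt.hasFDerivAt
  have hl := ((hasFDerivAt_metricForm hx).clm_apply h).clm_apply (hasFDerivAt_const c x)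
  have hr := ((((hasFDerivAt_cubicForm hx).clm_apply (hasFDerivAt_const a x)).clm_apply
    (hasFDerivAt_const b x)).clm_apply (hasFDerivAt_const c x)).const_mul (1 / 2)
  have he : (fun z => metricForm M z (connectionForm M z a b) c)
      =ᶠ[𝓝 x] fun z => (1 / 2) * cubicForm M z a b c := by
    filter_upwards [M.isOpen.mem_nhds hx] with z hz using metricForm_connectionForm hz a b c
  have := DFunLike.congr_fun (hl.unique (hr.congr_of_eventuallyEq he)) u
  simp at this
  linarith

theorem riemann_eq (hx : x ∈ M.carrier) (u v w : Fin n → ℝ) :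
    riemann M x u v w = fderiv ℝ (fun z => connectionForm M z v w) x u
      - fderiv ℝ (fun z => connectionForm M z u w) x v
      + connectionForm M x u (connectionForm M x v w)
      - connectionForm M x v (connectionForm M x u w) := by
  have h (u v w : Fin n → ℝ) (k : Fin n) : connectionForm M x u (connectionForm M x v w) k
      = ∑ i, ∑ j, ∑ l, (∑ m, christoffel M x k i m * christoffel M x m j l)
        * u i * v j * w l := by
    simp only [connectionForm, Finset.mul_sum, Finset.sum_mul]
    refine Finset.sum_congr rfl fun i _ => ?_
    rw [Finset.sum_comm]
    refine Finset.sum_congr rfl fun j _ => ?_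
    rw [Finset.sum_comm]
    refine Finset.sum_congr rfl fun l _ => Finset.sum_congr rfl fun m _ => ?_
    ring
  ext k
  simp only [Pi.sub_apply, Pi.add_apply, fderiv_connectionForm_apply hx, h, riemann, riemannCoeff]
  rw [Finset.sum_comm (f := fun l i => ∑ j, pderiv l (fun z => christoffel M z k i j) x
    * v l * u i * w j), Finset.sum_comm (f := fun i j => ∑ l, (∑ m, christoffel M x k i m *
    christoffel M x m j l) * v i * u j * w l)]
  simp only [← Finset.sum_sub_distrib, ← Finset.sum_add_distrib]
  refine Finset.sum_congr rfl fun i _ => Finset.sum_congr rfl fun j _ =>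
    Finset.sum_congr rfl fun l _ => ?_
  rw [Finset.sum_sub_distrib]
  ring

/-- The curvature of a Hessian metric in terms of the connection. -/
theorem metricForm_riemann (hx : x ∈ M.carrier) (u v c : Fin n → ℝ) :
    metricForm M x (riemann M x u v v) c
      = metricForm M x (connectionForm M x v c) (connectionForm M x u v)
        - metricForm M x (connectionForm M x u c) (connectionForm M x v v) := by
  rw [riemann_eq hx]
  simp only [map_sub, map_add, sub_apply, add_apply]
  -- The fourth derivatives of the potential cancel by symmetry, so the curvature is quadratic in
  -- the connection.
  rw [metricForm_fderiv_connectionForm hx, metricForm_fderiv_connectionForm hx,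
    metricForm_connectionForm hx, metricForm_connectionForm hx, metricForm_connectionForm hx,
    metricForm_connectionForm hx, quarticForm_comm hx u v v c,
    cubicForm_comm' hx u _ c, cubicForm_comm' hx v _ c]
  ring

theorem jacobiOperator_mulVec (v u : Fin n → ℝ) :
    jacobiOperator M x v *ᵥ u = riemann M x u v v := by
  ext k
  simp only [jacobiOperator, Matrix.mulVec, dotProduct, Matrix.of_apply, riemann, Finset.sum_mul]
  rw [Finset.sum_comm]
  refine Finset.sum_congr rfl fun i _ => ?_
  rw [Finset.sum_comm]
  refine Finset.sum_congr rfl fun j _ => ?_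
  rw [Finset.sum_comm]
  refine Finset.sum_congr rfl fun l _ => ?_
  rw [Finset.sum_eq_single i]
  · simp
    ring
  · intro b _ hb
    simp [hb.symm]
  · simp

/-! ### The drift -/

theorem hasFDerivAt_log_det_metric (hx : x ∈ M.carrier) :
    HasFDerivAt (fun z => Real.log (metric M z).det) (∑ i, ∑ j, (metric M x)⁻¹ i j •
      (((cubicForm M x).flip (Pi.single i 1)).flip (Pi.single j 1))) x := by
  refine ((hasFDerivAt_det (hasFDerivAt_metric hx)).log (det_metric_pos hx).ne').congr_fderiv ?_
  rw [Finset.smul_sum]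
  refine Finset.sum_congr rfl fun i _ => ?_
  rw [Finset.smul_sum]
  refine Finset.sum_congr rfl fun j _ => ?_
  rw [smul_smul, metric_inv_symm hx i j, Matrix.inv_def, Ring.inverse_eq_inv', Matrix.smul_apply,
    smul_eq_mul]

theorem contDiffAt_log_det_metric (hx : x ∈ M.carrier) :
    ContDiffAt ℝ ∞ (fun z => Real.log (metric M z).det) x :=
  (contDiffAt_det (contDiffAt_metric hx)).log (det_metric_pos hx).ne'

theorem contDiffAt_drift (hx : x ∈ M.carrier) : ContDiffAt ℝ ∞ (drift M) x := by
  unfold drift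
  refine contDiffAt_pi.mpr fun i => contDiffAt_const.mul (ContDiffAt.sum fun j _ => ?_)
  exact contDiffAt_pderiv (contDiffAt_metric_inv hx i j) j

/-- The derivative of the identity g g⁻¹ = 1. -/
theorem sum_metric_mul_pderiv_inv (hx : x ∈ M.carrier) (a l j : Fin n) :
    ∑ i, metric M x a i * pderiv l (fun z => (metric M z)⁻¹ i j) x
      = -∑ i, cubicForm M x (Pi.single l 1) (Pi.single a 1) (Pi.single i 1)
        * (metric M x)⁻¹ i j := by
  have h1 : HasFDerivAt (fun z => ∑ i, metric M z a i * (metric M z)⁻¹ i j) _ x :=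
    HasFDerivAt.fun_sum fun i _ => (hasFDerivAt_metric hx a i).mul
      ((contDiffAt_metric_inv hx i j).differentiableAt (by simp)).hasFDerivAt
  have h2 : (fun z => ∑ i, metric M z a i * (metric M z)⁻¹ i j) =ᶠ[𝓝 x]
      fun _ => (1 : Matrix (Fin n) (Fin n) ℝ) a j := by
    filter_upwards [M.isOpen.mem_nhds hx] with z hz
    rw [← metric_mul_inv hz, Matrix.mul_apply]
  have h3 := DFunLike.congr_fun (h1.unique ((hasFDerivAt_const _ x).congr_of_eventuallyEq h2))
    (Pi.single l 1)
  simp [Finset.sum_add_distrib] at h3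
  unfold pderiv
  rw [eq_neg_iff_add_eq_zero, ← h3]
  congr 1
  exact Finset.sum_congr rfl fun i _ => mul_comm _ _

/-- The drift is `-½` times the gradient of the logarithmic volume density. -/
theorem metricForm_drift (hx : x ∈ M.carrier) (c : Fin n → ℝ) :
    metricForm M x (drift M x) c
      = -(1 / 2) * fderiv ℝ (fun z => Real.log (metric M z).det) x c := by
  have h1 (a : Fin n) : (metric M x *ᵥ drift M x) a
      = -(1 / 2) * ∑ i, ∑ j, (metric M x)⁻¹ i j
        * cubicForm M x (Pi.single a 1) (Pi.single i 1) (Pi.single j 1) := by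
    have h2 : (metric M x *ᵥ drift M x) a
        = (1 / 2) * ∑ j, ∑ i, metric M x a i * pderiv j (fun z => (metric M z)⁻¹ i j) x := by
      simp only [Matrix.mulVec, dotProduct, drift, Finset.mul_sum]
      rw [Finset.sum_comm]
      refine Finset.sum_congr rfl fun j _ => Finset.sum_congr rfl fun i _ => ?_
      ring
    rw [h2, Finset.sum_congr rfl fun j _ => sum_metric_mul_pderiv_inv hx a j j,
      Finset.sum_neg_distrib, Finset.sum_comm]
    -- Total symmetry moves the index `a` to the front: the divergence of g⁻¹ becomes a trace g^{ij}
    -- ∂ₐg_{ij}, which is the derivative of log det g.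
    have h3 : ∀ i j, cubicForm M x (Pi.single j 1) (Pi.single a 1) (Pi.single i 1)
        * (metric M x)⁻¹ i j = (metric M x)⁻¹ i j
        * cubicForm M x (Pi.single a 1) (Pi.single i 1) (Pi.single j 1) := by
      intro i j
      rw [cubicForm_comm hx, cubicForm_comm' hx, mul_comm]
    simp only [h3]
    ring
  rw [metricForm_comm hx, metricForm_eq_dotProduct hx, (hasFDerivAt_log_det_metric hx).fderiv]
  simp only [dotProduct, h1, sum_apply, smul_apply, smul_eq_mul, ContinuousLinearMap.flip_apply]
  rw [Finset.mul_sum]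
  have h4 : ∀ i j, cubicForm M x c (Pi.single i 1) (Pi.single j 1)
      = ∑ a, c a * cubicForm M x (Pi.single a 1) (Pi.single i 1) (Pi.single j 1) := by
    intro i j
    rw [apply_eq_sum_single (cubicForm M x) c]
    simp only [sum_apply, smul_apply, smul_eq_mul]
  simp only [h4, Finset.mul_sum]
  rw [Finset.sum_comm]
  refine Finset.sum_congr rfl fun i _ => ?_
  rw [Finset.sum_comm]
  refine Finset.sum_congr rfl fun j _ => Finset.sum_congr rfl fun a _ => ?_
  ring

/-! ### The Frobenius norm -/

open scoped MatrixOrder Matrix.Norms.L2Operator in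
theorem exists_metric_eq_transpose_mul (hx : x ∈ M.carrier) :
    ∃ B : Matrix (Fin n) (Fin n) ℝ, IsUnit B ∧ metric M x = Bᵀ * B := by
  obtain ⟨B, hB⟩ := CStarAlgebra.nonneg_iff_eq_star_mul_self.mp
    (posDef_metric hx).posSemidef.nonneg
  refine ⟨B, ?_, hB⟩
  have h := (posDef_metric hx).isUnit
  rw [hB, Matrix.isUnit_iff_isUnit_det, Matrix.det_mul] at h
  exact (Matrix.isUnit_iff_isUnit_det B).mpr (isUnit_of_mul_isUnit_right h)

/-- Writing g = BᵀB and conjugating `A` by `B` turns the metric into the Euclidean one; there the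
bound is Cauchy–Schwarz over pairs of indices. -/
theorem metricForm_mulVec_le (hx : x ∈ M.carrier) (A : Matrix (Fin n) (Fin n) ℝ)
    (u : Fin n → ℝ) :
    metricForm M x (A *ᵥ u) u ≤ frobeniusNorm M x A * metricForm M x u u := by
  obtain ⟨B, hB, hgB⟩ := exists_metric_eq_transpose_mul hx
  set g := metric M x with hg
  set C := B * A * B⁻¹ with hC
  have hBdet : IsUnit B.det := (Matrix.isUnit_iff_isUnit_det B).mp hB
  have hCB : C * B = B * A := by
    rw [hC, Matrix.mul_assoc, Matrix.nonsing_inv_mul _ hBdet, Matrix.mul_one]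
  have h1 : (g⁻¹ * Aᵀ * g * A).trace = ∑ i, ∑ j, C j i ^ 2 := by
    have h2 : (g⁻¹ * Aᵀ * g * A).trace = (Cᵀ * C).trace := by
      rw [hgB, Matrix.mul_inv_rev, hC]
      simp only [Matrix.transpose_mul, Matrix.transpose_nonsing_inv, Matrix.mul_assoc]
      rw [Matrix.trace_mul_comm]
      simp only [Matrix.mul_assoc]
    rw [h2]
    simp only [Matrix.trace, Matrix.diag_apply, Matrix.mul_apply, Matrix.transpose_apply, sq]
  have h3 (a b : Fin n → ℝ) : metricForm M x a b = (B *ᵥ a) ⬝ᵥ (B *ᵥ b) := by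
    rw [metricForm_eq_dotProduct hx, ← hg, hgB, ← Matrix.mulVec_mulVec, Matrix.dotProduct_mulVec,
      Matrix.vecMul_transpose]
  have h4 : B *ᵥ (A *ᵥ u) = C *ᵥ (B *ᵥ u) := by
    rw [Matrix.mulVec_mulVec, Matrix.mulVec_mulVec, hCB]
  rw [h3, h3, h4, frobeniusNorm, ← hg, h1]
  set p := B *ᵥ u
  have h5 : (C *ᵥ p) ⬝ᵥ p = ∑ q : Fin n × Fin n, C q.2 q.1 * (p q.1 * p q.2) := by
    simp only [dotProduct, Matrix.mulVec, Finset.sum_mul, Fintype.sum_prod_type]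
    rw [Finset.sum_comm]
    refine Finset.sum_congr rfl fun i _ => Finset.sum_congr rfl fun j _ => ?_
    ring
  have h6 : ∑ q : Fin n × Fin n, (p q.1 * p q.2) ^ 2 = (p ⬝ᵥ p) ^ 2 := by
    simp only [dotProduct, Fintype.sum_prod_type, sq, Finset.sum_mul_sum]
    refine Finset.sum_congr rfl fun i _ => Finset.sum_congr rfl fun j _ => ?_
    ring
  have h7 : 0 ≤ p ⬝ᵥ p := Finset.sum_nonneg fun i _ => mul_self_nonneg _
  rw [h5]
  refine (Real.sum_mul_le_sqrt_mul_sqrt _ _ _).trans (le_of_eq ?_)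
  rw [h6, Real.sqrt_sq h7, Fintype.sum_prod_type]

theorem frobeniusNorm_smul {r : ℝ} (hr : 0 ≤ r) (A : Matrix (Fin n) (Fin n) ℝ) :
    frobeniusNorm M x (r • A) = r * frobeniusNorm M x A := by
  have h : (((metric M x)⁻¹ * (r • A)ᵀ * metric M x * (r • A)).trace)
      = r ^ 2 * ((metric M x)⁻¹ * Aᵀ * metric M x * A).trace := by
    simp only [Matrix.transpose_smul, Matrix.mul_smul, Matrix.smul_mul, Matrix.trace_smul,
      smul_eq_mul]
    ring
  rw [frobeniusNorm, h, Real.sqrt_mul (sq_nonneg r), Real.sqrt_sq hr, frobeniusNorm]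

theorem jacobiOperator_smul (r : ℝ) (v : Fin n → ℝ) :
    jacobiOperator M x (r • v) = r ^ 2 • jacobiOperator M x v := by
  ext k i
  simp only [jacobiOperator, Matrix.of_apply, riemann, Matrix.smul_apply, smul_eq_mul,
    Pi.smul_apply, Finset.mul_sum]
  refine Finset.sum_congr rfl fun i _ => Finset.sum_congr rfl fun j _ =>
    Finset.sum_congr rfl fun l _ => ?_
  ring

end Connection

end GeodesicWalk

namespace GeodesicWalk

open Set Filter
open scoped Topology ContDiff Matrix

/-! ### Jacobi fields -/

section Jacobi

set_option synthInstance.maxHeartbeats 200000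
set_option maxSynthPendingDepth 3

variable {n : ℕ} (M : HessianManifold n)

/-- `γ` is a geodesic on `[0, T]` with velocity `v`. -/
structure IsGeodesicFlow (T : ℝ) (γ v : ℝ → Fin n → ℝ) : Prop where
  mem : ∀ t ∈ Icc 0 T, γ t ∈ M.carrier
  hasDerivWithinAt : ∀ t ∈ Icc 0 T, HasDerivWithinAt γ (v t) (Icc 0 T) t
  hasDerivWithinAt_velocity : ∀ t ∈ Icc 0 T,
    HasDerivWithinAt v (geodesicField M (γ t, v t)).2 (Icc 0 T) t

/-- `J` is a Jacobi field along `γ` on `[0, 1]` with coordinate derivative `K`: it solves the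
linearized geodesic equation. -/
structure IsJacobiField (γ v J K : ℝ → Fin n → ℝ) : Prop where
  hasDerivWithinAt : ∀ t ∈ Icc (0 : ℝ) 1, HasDerivWithinAt J (K t) (Icc 0 1) t
  equation : ∀ t ∈ Icc (0 : ℝ) 1, ∃ b, HasDerivWithinAt K b (Icc 0 1) t ∧
    ∀ u, metricForm M (γ t) b u = -(1 / 2) * quarticForm M (γ t) (J t) (v t) (v t) u
      - cubicForm M (γ t) (v t) (K t) u
      - cubicForm M (γ t) (J t) (geodesicField M (γ t, v t)).2 u

/-- The covector dual to the covariant derivative of a vector field `J` along `γ`. -/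
noncomputable def covariantMomentum (γ v J K : ℝ → Fin n → ℝ) (t : ℝ) : (Fin n → ℝ) →L[ℝ] ℝ :=
  metricForm M (γ t) (K t) + (1 / 2 : ℝ) • cubicForm M (γ t) (v t) (J t)

variable {M} {γ v J K J₁ K₁ J₂ K₂ : ℝ → Fin n → ℝ} {T : ℝ}

theorem connectionForm_comm {x : Fin n → ℝ} (hx : x ∈ M.carrier) (a b : Fin n → ℝ) :
    connectionForm M x a b = connectionForm M x b a := by
  refine eq_of_metricForm_eq hx fun c => ?_
  rw [metricForm_connectionForm hx, metricForm_connectionForm hx, cubicForm_comm hx]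

theorem accel_smul (x a : Fin n → ℝ) (r : ℝ) :
    (geodesicField M (x, r • a)).2 = r ^ 2 • (geodesicField M (x, a)).2 := by
  ext k
  simp only [geodesicField, connectionForm, Pi.smul_apply, Pi.neg_apply, smul_eq_mul, mul_neg,
    Finset.mul_sum]
  refine congrArg _ (Finset.sum_congr rfl fun i _ => Finset.sum_congr rfl fun j _ => ?_)
  ring

theorem accel_neg (x a : Fin n → ℝ) :
    (geodesicField M (x, -a)).2 = (geodesicField M (x, a)).2 := by
  simpa using accel_smul (M := M) x a (-1)

theorem one_sub_mem_Icc {t : ℝ} (ht : t ∈ Icc (0 : ℝ) 1) : 1 - t ∈ Icc (0 : ℝ) 1 :=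
  ⟨by linarith [ht.2], by linarith [ht.1]⟩

theorem hasDerivWithinAt_reverse {f : ℝ → Fin n → ℝ} {d : Fin n → ℝ} {t : ℝ}
    (hf : HasDerivWithinAt f d (Icc 0 1) (1 - t)) :
    HasDerivWithinAt (fun s => f (1 - s)) (-d) (Icc 0 1) t := by
  have h := HasDerivWithinAt.scomp t hf
    (((hasDerivAt_id t).const_sub 1).hasDerivWithinAt (s := Icc (0 : ℝ) 1))
    (fun s hs => one_sub_mem_Icc hs)
  rw [neg_one_smul] at h
  exact h

theorem IsGeodesicFlow.hasDerivWithinAt_metricForm (hγ : IsGeodesicFlow M T γ v) {t : ℝ}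
    (ht : t ∈ Icc 0 T) :
    HasDerivWithinAt (fun s => metricForm M (γ s)) (cubicForm M (γ t) (v t)) (Icc 0 T) t :=
  (hasFDerivAt_metricForm (hγ.mem t ht)).comp_hasDerivWithinAt t (hγ.hasDerivWithinAt t ht)

theorem IsGeodesicFlow.hasDerivWithinAt_cubicForm (hγ : IsGeodesicFlow M T γ v) {t : ℝ}
    (ht : t ∈ Icc 0 T) :
    HasDerivWithinAt (fun s => cubicForm M (γ s)) (quarticForm M (γ t) (v t)) (Icc 0 T) t :=
  (hasFDerivAt_cubicForm (hγ.mem t ht)).comp_hasDerivWithinAt t (hγ.hasDerivWithinAt t ht)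

/-- Geodesics have constant speed. -/
theorem IsGeodesicFlow.metricForm_velocity (hγ : IsGeodesicFlow M T γ v) (hT : 0 ≤ T) :
    metricForm M (γ T) (v T) (v T) = metricForm M (γ 0) (v 0) (v 0) := by
  have hd : ∀ t ∈ Icc 0 T,
      HasDerivWithinAt (fun s => metricForm M (γ s) (v s) (v s)) 0 (Icc 0 T) t := by
    intro t ht
    have hx := hγ.mem t ht
    have h := ((hγ.hasDerivWithinAt_metricForm ht).clm_apply
      (hγ.hasDerivWithinAt_velocity t ht)).clm_apply (hγ.hasDerivWithinAt_velocity t ht)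
    refine h.congr_deriv ?_
    simp only [add_apply]
    rw [metricForm_comm hx (v t), metricForm_accel hx]
    ring
  refine constant_of_has_deriv_right_zero (fun t ht => (hd t ht).continuousWithinAt)
    (fun t ht => ?_) T ⟨hT, le_rfl⟩
  exact (hd t (Ico_subset_Icc_self ht)).mono_of_mem_nhdsWithin (Icc_mem_nhdsGE_of_mem ht)

/-- The fourth derivative in the Jacobi equation cancels against the one from differentiating the
connection term of the momentum. -/
theorem IsJacobiField.hasDerivWithinAt_covariantMomentum (hγ : IsGeodesicFlow M 1 γ v)
    (hJ : IsJacobiField M γ v J K) {t : ℝ} (ht : t ∈ Icc (0 : ℝ) 1) :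
    HasDerivWithinAt (covariantMomentum M γ v J K)
      ((1 / 2 : ℝ) • (cubicForm M (γ t) (v t) (K t)
        - cubicForm M (γ t) (J t) (geodesicField M (γ t, v t)).2)) (Icc 0 1) t := by
  obtain ⟨b, hb, he⟩ := hJ.equation t ht
  have hx := hγ.mem t ht
  have h := ((hγ.hasDerivWithinAt_metricForm ht).clm_apply hb).add
    ((((hγ.hasDerivWithinAt_cubicForm ht).clm_apply (hγ.hasDerivWithinAt_velocity t ht)).clm_apply
      (hJ.hasDerivWithinAt t ht)).const_smul (1 / 2 : ℝ))
  refine h.congr_deriv ?_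
  ext u
  simp only [add_apply, smul_apply, sub_apply, smul_eq_mul]
  rw [he, quarticForm_comm hx (J t), quarticForm_comm' hx (v t) (J t),
    cubicForm_comm hx (J t)]
  ring

theorem IsJacobiField.hasDerivWithinAt_momentum_apply (hγ : IsGeodesicFlow M 1 γ v)
    (h₁ : IsJacobiField M γ v J₁ K₁) (h₂ : IsJacobiField M γ v J₂ K₂) {t : ℝ}
    (ht : t ∈ Icc (0 : ℝ) 1) :
    HasDerivWithinAt (fun s => covariantMomentum M γ v J₁ K₁ s (J₂ s))
      (metricForm M (γ t) (K₁ t) (K₂ t) + (1 / 2) * (cubicForm M (γ t) (v t) (K₁ t) (J₂ t)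
        + cubicForm M (γ t) (v t) (J₁ t) (K₂ t)
        - cubicForm M (γ t) (J₁ t) (geodesicField M (γ t, v t)).2 (J₂ t))) (Icc 0 1) t := by
  have h := (h₁.hasDerivWithinAt_covariantMomentum hγ ht).clm_apply (h₂.hasDerivWithinAt t ht)
  refine h.congr_deriv ?_
  simp only [covariantMomentum, add_apply, smul_apply, sub_apply, smul_eq_mul]
  ring

/-- The Wronskian of two Jacobi fields is constant. -/
theorem IsJacobiField.wronskian_eq (hγ : IsGeodesicFlow M 1 γ v)
    (h₁ : IsJacobiField M γ v J₁ K₁) (h₂ : IsJacobiField M γ v J₂ K₂) :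
    covariantMomentum M γ v J₁ K₁ 1 (J₂ 1) - covariantMomentum M γ v J₂ K₂ 1 (J₁ 1)
      = covariantMomentum M γ v J₁ K₁ 0 (J₂ 0) - covariantMomentum M γ v J₂ K₂ 0 (J₁ 0) := by
  have hd : ∀ t ∈ Icc (0 : ℝ) 1, HasDerivWithinAt (fun s => covariantMomentum M γ v J₁ K₁ s (J₂ s)
      - covariantMomentum M γ v J₂ K₂ s (J₁ s)) 0 (Icc 0 1) t := by
    intro t ht
    have hx := hγ.mem t ht
    refine ((h₁.hasDerivWithinAt_momentum_apply hγ h₂ ht).sub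
      (h₂.hasDerivWithinAt_momentum_apply hγ h₁ ht)).congr_deriv ?_
    rw [metricForm_comm hx (K₁ t), cubicForm_comm' hx (v t) (K₁ t),
      cubicForm_comm' hx (v t) (J₁ t), cubicForm_comm' hx (J₁ t), cubicForm_comm hx (J₁ t),
      cubicForm_comm' hx (J₂ t)]
    ring
  refine constant_of_has_deriv_right_zero (fun t ht => (hd t ht).continuousWithinAt)
    (fun t ht => ?_) 1 ⟨zero_le_one, le_rfl⟩
  exact (hd t (Ico_subset_Icc_self ht)).mono_of_mem_nhdsWithin (Icc_mem_nhdsGE_of_mem ht)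

theorem IsJacobiField.reverse (hJ : IsJacobiField M γ v J K) :
    IsJacobiField M (fun t => γ (1 - t)) (fun t => -v (1 - t)) (fun t => J (1 - t))
      (fun t => -K (1 - t)) := by
  refine ⟨fun t ht => hasDerivWithinAt_reverse (hJ.hasDerivWithinAt _ (one_sub_mem_Icc ht)), fun t ht => ?_⟩
  obtain ⟨b, hb, he⟩ := hJ.equation _ (one_sub_mem_Icc ht)
  refine ⟨b, by simpa [Pi.neg_def] using (hasDerivWithinAt_reverse hb).neg, fun u => ?_⟩
  rw [he]
  simp [accel_neg]

theorem IsGeodesicFlow.reverse (hγ : IsGeodesicFlow M 1 γ v) :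
    IsGeodesicFlow M 1 (fun t => γ (1 - t)) (fun t => -v (1 - t)) := by
  refine ⟨fun t ht => hγ.mem _ (one_sub_mem_Icc ht), fun t ht => hasDerivWithinAt_reverse (hγ.hasDerivWithinAt _ (one_sub_mem_Icc ht)),
    fun t ht => ?_⟩
  have h := (hasDerivWithinAt_reverse
    (hγ.hasDerivWithinAt_velocity _ (one_sub_mem_Icc ht))).neg
  rw [neg_neg] at h
  rw [accel_neg]
  exact h

/-- If the curvature along a geodesic on `[0, 1]` is at most `1`, then a nonzero Jacobi field that
vanishes at `0` does not vanish again. -/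
theorem IsJacobiField.eq_zero_of_vanish (hγ : IsGeodesicFlow M 1 γ v)
    (hR : ∀ t ∈ Icc (0 : ℝ) 1, frobeniusNorm M (γ t) (jacobiOperator M (γ t) (v t)) ≤ 1)
    (hJ : IsJacobiField M γ v J K) (h0 : J 0 = 0) {s : ℝ} (hs : s ∈ Ioc (0 : ℝ) 1)
    (hJs : J s = 0) : K 0 = 0 := by
  have hsub : Icc 0 s ⊆ Icc (0 : ℝ) 1 := Icc_subset_Icc_right hs.2
  -- With θ = 2t - 1 and covariant derivative DJ, Φ = ⟨DJ, J⟩ + θ‖J‖². Its derivative is ‖DJ + θJ‖²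
  -- + (2 - θ²)‖J‖² - ⟨R(J,v)v, J⟩ ≥ (1 - θ²)‖J‖², because θ' = 2 and the curvature is at most 1.
  -- The choice of θ keeps 1 - θ² positive inside (0, 1).
  set Φ : ℝ → ℝ := fun t => covariantMomentum M γ v J K t (J t)
    + (2 * t - 1) * metricForm M (γ t) (J t) (J t) with hΦ
  have hd : ∀ t ∈ Icc (0 : ℝ) 1, ∃ d, HasDerivWithinAt Φ d (Icc 0 1) t ∧
      (1 - (2 * t - 1) ^ 2) * metricForm M (γ t) (J t) (J t) ≤ d := by
    intro t ht
    have hx := hγ.mem t ht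
    have hG := ((hγ.hasDerivWithinAt_metricForm ht).clm_apply
      (hJ.hasDerivWithinAt t ht)).clm_apply (hJ.hasDerivWithinAt t ht)
    have hθ : HasDerivWithinAt (fun r : ℝ => 2 * r - 1) 2 (Icc 0 1) t := by
      simpa using (((hasDerivAt_id t).const_mul 2).sub_const 1).hasDerivWithinAt
    refine ⟨_, (hJ.hasDerivWithinAt_momentum_apply hγ hJ ht).add (hθ.mul hG), ?_⟩
    set Y := connectionForm M (γ t) (v t) (J t) with hY
    have e1 : ∀ u, metricForm M (γ t) Y u = (1 / 2) * cubicForm M (γ t) (v t) (J t) u :=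
      metricForm_connectionForm hx _ _
    have e2 : metricForm M (γ t) (riemann M (γ t) (J t) (v t) (v t)) (J t)
        = metricForm M (γ t) Y Y
          + (1 / 2) * cubicForm M (γ t) (J t) (J t) (geodesicField M (γ t, v t)).2 := by
      rw [metricForm_riemann hx, connectionForm_comm hx (J t) (v t), ← hY,
        metricForm_connectionForm hx (J t)]
      simp only [geodesicField, map_neg]
      ring
    have e3 := metricForm_mulVec_le hx (jacobiOperator M (γ t) (v t)) (J t)
    rw [jacobiOperator_mulVec, e2] at e3
    have e4 : 0 ≤ metricForm M (γ t) (J t) (J t) := metricForm_self_nonneg hx _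
    have e5 := mul_le_mul_of_nonneg_right (hR t ht) e4
    -- The completed square, since K + Y is the covariant derivative of J.
    have e6 := metricForm_self_nonneg hx (K t + Y + (2 * t - 1) • J t)
    simp only [map_add, map_smul, add_apply, smul_apply, smul_eq_mul, e1,
      metricForm_comm hx (J t) Y, metricForm_comm hx (K t) Y, metricForm_comm hx (J t) (K t)] at e6
    simp only [add_apply]
    rw [e1] at e3
    rw [cubicForm_comm' hx (v t) (K t), cubicForm_comm' hx (J t) _ (J t),
      metricForm_comm hx (J t) (K t)]
    nlinarith [e3, e5, e6]
  have hnonneg : ∀ t ∈ Icc (0 : ℝ) 1,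
      0 ≤ (1 - (2 * t - 1) ^ 2) * metricForm M (γ t) (J t) (J t) := by
    intro t ht
    refine mul_nonneg ?_ (metricForm_self_nonneg (hγ.mem t ht) _)
    nlinarith [ht.1, ht.2]
  have hcont : ContinuousOn Φ (Icc 0 1) := fun t ht => by
    obtain ⟨d, hd, -⟩ := hd t ht
    exact hd.continuousWithinAt
  have hat : ∀ t ∈ Ioo 0 s, ∃ d, HasDerivAt Φ d t ∧
      (1 - (2 * t - 1) ^ 2) * metricForm M (γ t) (J t) (J t) ≤ d := by
    intro t ht
    obtain ⟨d, hd1, hd2⟩ := hd t (hsub (Ioo_subset_Icc_self ht))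
    exact ⟨d, hd1.hasDerivAt (Icc_mem_nhds ht.1 (ht.2.trans_le hs.2)), hd2⟩
  have hmono : MonotoneOn Φ (Icc 0 s) := by
    refine monotoneOn_of_deriv_nonneg (convex_Icc 0 s) (hcont.mono hsub) ?_ ?_
    · rw [interior_Icc]
      intro t ht
      obtain ⟨d, hd1, -⟩ := hat t ht
      exact hd1.differentiableAt.differentiableWithinAt
    · rw [interior_Icc]
      intro t ht
      obtain ⟨d, hd1, hd2⟩ := hat t ht
      rw [hd1.deriv]
      exact (hnonneg t (hsub (Ioo_subset_Icc_self ht))).trans hd2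
  have hΦ0 : Φ 0 = 0 := by simp [hΦ, h0]
  have hΦs : Φ s = 0 := by simp [hΦ, hJs]
  -- A monotone function with equal end values is constant; its vanishing derivative then forces J =
  -- 0 between the two zeros.
  have hΦz : ∀ t ∈ Icc 0 s, Φ t = 0 := fun t ht => le_antisymm
    (hΦs ▸ hmono ht ⟨hs.1.le, le_rfl⟩ ht.2) (hΦ0 ▸ hmono ⟨le_rfl, hs.1.le⟩ ht ht.1)
  have hJz : ∀ t ∈ Ioo 0 s, J t = 0 := by
    intro t ht
    obtain ⟨d, hd1, hd2⟩ := hat t ht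
    have h1 : d = 0 := by
      refine hd1.unique ((hasDerivAt_const t (0 : ℝ)).congr_of_eventuallyEq ?_)
      filter_upwards [Ioo_mem_nhds ht.1 ht.2] with r hr using hΦz r (Ioo_subset_Icc_self hr)
    by_contra hne
    have h2 := metricForm_self_pos (hγ.mem t (hsub (Ioo_subset_Icc_self ht))) hne
    have h3 : 0 < 1 - (2 * t - 1) ^ 2 := by nlinarith [ht.1, ht.2, hs.2]
    linarith [mul_pos h3 h2]
  have h1 : HasDerivWithinAt J (K 0) (Icc 0 s) 0 :=
    (hJ.hasDerivWithinAt 0 ⟨le_rfl, zero_le_one⟩).mono hsub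
  have h2 : HasDerivWithinAt J 0 (Icc 0 s) 0 := by
    refine (hasDerivWithinAt_const 0 (Icc 0 s) (0 : Fin n → ℝ)).congr (fun t ht => ?_) h0
    rcases eq_or_lt_of_le ht.1 with h | h
    · rw [← h, h0]
    · rcases eq_or_lt_of_le ht.2 with h' | h'
      · rw [h', hJs]
      · exact hJz t ⟨h, h'⟩
  exact (uniqueDiffOn_Icc hs.1 0 ⟨le_rfl, hs.1.le⟩).eq_deriv _ h1 h2

/-- The determinant of the Jacobi fields vanishing at `0` is positive if the curvature is at
most `1`. -/
theorem det_jacobiField_pos (hγ : IsGeodesicFlow M 1 γ v)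
    (hR : ∀ t ∈ Icc (0 : ℝ) 1, frobeniusNorm M (γ t) (jacobiOperator M (γ t) (v t)) ≤ 1)
    {𝓙 𝓚 : ℝ → (Fin n → ℝ) →L[ℝ] (Fin n → ℝ)}
    (hJ : ∀ w, IsJacobiField M γ v (fun t => 𝓙 t w) (fun t => 𝓚 t w))
    (hJ0 : ∀ w, 𝓙 0 w = 0) (hK0 : ∀ w, 𝓚 0 w = w) : 0 < (𝓙 1).det := by
  let A : ℝ → Matrix (Fin n) (Fin n) ℝ := fun t => LinearMap.toMatrix' (𝓙 t).toLinearMap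
  have hA : ∀ t i j, A t i j = 𝓙 t (Pi.single j 1) i := fun t i j => by
    simp [A, LinearMap.toMatrix'_apply]
  have hdet : ∀ t, (𝓙 t).det = (A t).det := fun t => (LinearMap.det_toMatrix' _).symm
  have hAe : ∀ i j, ∀ t ∈ Icc (0 : ℝ) 1,
      HasDerivWithinAt (fun t => A t i j) (𝓚 t (Pi.single j 1) i) (Icc 0 1) t := by
    intro i j t ht
    simp only [hA]
    exact (hasDerivWithinAt_pi.mp ((hJ (Pi.single j 1)).hasDerivWithinAt t ht)) i
  have hAc : ContinuousOn (fun t => (A t).det) (Icc 0 1) := by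
    have h : ContinuousOn A (Icc 0 1) := by
      refine continuousOn_pi.mpr fun i => continuousOn_pi.mpr fun j t ht => ?_
      exact (hAe i j t ht).continuousWithinAt
    exact Continuous.comp_continuousOn (g := Matrix.det) (Continuous.matrix_det continuous_id) h
  have hne : ∀ t ∈ Ioc (0 : ℝ) 1, (A t).det ≠ 0 := by
    intro t ht h
    -- A kernel vector is the initial derivative of a Jacobi field vanishing at 0 and at `t`, hence
    -- zero.
    obtain ⟨w, hw, hw0⟩ := Matrix.exists_mulVec_eq_zero_iff.mpr h
    have h1 : 𝓙 t w = 0 := by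
      rw [← hw0]
      exact (LinearMap.toMatrix'_mulVec _ _).symm
    exact hw ((hK0 w).symm.trans ((hJ w).eq_zero_of_vanish hγ hR (hJ0 w) ht h1))
  obtain ⟨ε, hε, hεpos⟩ : ∃ ε ∈ Ioo (0 : ℝ) 1, 0 < (A ε).det := by
    -- A(0) = 0 and A'(0) = 1, so the determinant starts out positive; having no zero on (0, 1], it
    -- stays positive by the intermediate value theorem.
    have h1 : Tendsto (fun t : ℝ => t⁻¹ • A t) (𝓝[>] 0) (𝓝 1) := by
      refine tendsto_pi_nhds.mpr fun i => tendsto_pi_nhds.mpr fun j => ?_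
      have h2 := (hAe i j 0 ⟨le_rfl, zero_le_one⟩).mono (Ioo_subset_Icc_self)
      rw [hasDerivWithinAt_iff_tendsto_slope' (by simp)] at h2
      rw [hK0, nhdsWithin_Ioo_eq_nhdsGT zero_lt_one] at h2
      have h3 : (Pi.single j (1 : ℝ) : Fin n → ℝ) i = (1 : Matrix (Fin n) (Fin n) ℝ) i j := by
        rw [Matrix.one_apply, Pi.single_apply]
      rw [h3] at h2
      refine h2.congr fun t => ?_
      simp [slope, hA, hJ0]
    have h4 : Tendsto (fun t : ℝ => (t⁻¹ • A t).det) (𝓝[>] 0) (𝓝 1) := by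
      have h5 := ((Continuous.matrix_det continuous_id).tendsto
        (1 : Matrix (Fin n) (Fin n) ℝ)).comp h1
      simp only [id, Matrix.det_one] at h5
      exact h5
    obtain ⟨ε, h5, h6⟩ := ((h4.eventually (lt_mem_nhds zero_lt_one)).and
      (Ioo_mem_nhdsGT zero_lt_one)).exists
    refine ⟨ε, h6, ?_⟩
    rw [Matrix.det_smul] at h5
    exact pos_of_mul_pos_right h5 (pow_nonneg (inv_nonneg.mpr h6.1.le) _)
  rw [hdet]
  by_contra hneg
  rw [not_lt] at hneg
  have h7 := intermediate_value_Icc' hε.2.le (hAc.mono (Icc_subset_Icc_left hε.1.le))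
  obtain ⟨t, ht, h8⟩ := h7 ⟨hneg, hεpos.le⟩
  exact hne t ⟨hε.1.trans_le ht.1, ht.2⟩ h8

/-- The two matrices of Jacobi fields along a geodesic that vanish at either end are transposes
of each other with respect to the metric. -/
theorem metricForm_jacobiField_symm (hγ : IsGeodesicFlow M 1 γ v)
    (h₁ : IsJacobiField M γ v J₁ K₁) (h₁0 : J₁ 0 = 0)
    (h₂ : IsJacobiField M (fun t => γ (1 - t)) (fun t => -v (1 - t)) J₂ K₂) (h₂0 : J₂ 0 = 0) :
    metricForm M (γ 0) (K₁ 0) (J₂ 1) = metricForm M (γ 1) (K₂ 0) (J₁ 1) := by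
  -- Read backwards, the second field is a Jacobi field along γ itself. Each field vanishes at its
  -- own end, leaving one Wronskian term at each endpoint.
  have h := h₁.wronskian_eq hγ (by simpa using h₂.reverse)
  simpa [covariantMomentum, h₁0, h₂0] using h.symm

/-- Adjointness is the matrix identity g(x) L' = (g(y) L)ᵀ; determinants are then taken. -/
theorem det_eq_of_metricForm_symm {x y : Fin n → ℝ} (hx : x ∈ M.carrier) (hy : y ∈ M.carrier)
    {L L' : (Fin n → ℝ) →L[ℝ] (Fin n → ℝ)}
    (h : ∀ u w, metricForm M x w (L' u) = metricForm M y u (L w)) :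
    (metric M x).det * L'.det = (metric M y).det * L.det := by
  set A := LinearMap.toMatrix' L.toLinearMap
  set A' := LinearMap.toMatrix' L'.toLinearMap
  have hA : ∀ w, L w = A *ᵥ w := fun w => (LinearMap.toMatrix'_mulVec _ _).symm
  have hA' : ∀ w, L' w = A' *ᵥ w := fun w => (LinearMap.toMatrix'_mulVec _ _).symm
  have h1 : metric M x * A' = (metric M y * A)ᵀ := by
    ext i j
    have h2 := h (Pi.single j 1) (Pi.single i 1)
    rw [metricForm_eq_dotProduct hx, metricForm_eq_dotProduct hy, hA, hA',
      Matrix.mulVec_mulVec, Matrix.mulVec_mulVec] at h2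
    simpa using h2
  have h3 := congrArg Matrix.det h1
  rw [Matrix.det_transpose, Matrix.det_mul, Matrix.det_mul] at h3
  have e : L.det = A.det := (LinearMap.det_toMatrix' _).symm
  have e' : L'.det = A'.det := (LinearMap.det_toMatrix' _).symm
  rw [e, e', h3]

end Jacobi

end GeodesicWalk

namespace GeodesicWalk

open Set Filter
open scoped Topology ContDiff Matrix

/-! ### The exponential map and its derivative -/

section Exponential

set_option synthInstance.maxHeartbeats 200000
set_option maxSynthPendingDepth 3

variable {n : ℕ} {M : HessianManifold n} {γ v : ℝ → Fin n → ℝ} {T : ℝ}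

theorem IsGeodesic.isGeodesicFlow (hT : 0 < T) (hγ : IsGeodesic M T γ) :
    IsGeodesicFlow M T γ (velocity γ T) := by
  have hu := uniqueDiffOn_Icc hT
  have hv : ContDiffOn ℝ 1 (velocity γ T) (Icc 0 T) :=
    hγ.contDiffOn.derivWithin hu (by norm_num)
  refine ⟨hγ.mem, fun t ht => ?_, fun t ht => ?_⟩
  · exact ((hγ.contDiffOn.differentiableOn (by norm_num)) t ht).hasDerivWithinAt
  · have h := ((hv.differentiableOn (by norm_num)) t ht).hasDerivWithinAt
    refine h.congr_deriv ?_
    ext k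
    exact eq_neg_of_add_eq_zero_left (hγ.equation t ht k)

theorem IsGeodesicFlow.hasDerivWithinAt_prod (hγ : IsGeodesicFlow M T γ v) {t : ℝ}
    (ht : t ∈ Icc 0 T) :
    HasDerivWithinAt (fun s => (γ s, v s)) (geodesicField M (γ t, v t)) (Icc 0 T) t :=
  (hγ.hasDerivWithinAt t ht).prodMk (hγ.hasDerivWithinAt_velocity t ht)

theorem isGeodesicFlow_of_prod {z : ℝ → (Fin n → ℝ) × (Fin n → ℝ)}
    (hz : ∀ t ∈ Icc 0 T, z t ∈ M.carrier ×ˢ univ ∧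
      HasDerivWithinAt z (geodesicField M (z t)) (Icc 0 T) t) :
    IsGeodesicFlow M T (fun t => (z t).1) (fun t => (z t).2) :=
  ⟨fun t ht => (hz t ht).1.1,
    fun t ht => (ContinuousLinearMap.fst ℝ (Fin n → ℝ) (Fin n → ℝ)).hasFDerivAt.comp_hasDerivWithinAt
      t (hz t ht).2,
    fun t ht => (ContinuousLinearMap.snd ℝ (Fin n → ℝ) (Fin n → ℝ)).hasFDerivAt.comp_hasDerivWithinAt
      t (hz t ht).2⟩

/-- Regularity bootstraps through the smooth geodesic equation. Geodesics are only assumed C², while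
the trapezoidal rule needs three derivatives along them. -/
theorem IsGeodesicFlow.contDiffOn_prod (hγ : IsGeodesicFlow M T γ v) :
    ContDiffOn ℝ ∞ (fun s => (γ s, v s)) (Icc 0 T) := by
  refine ODE.contDiffOn_enat_Icc_of_hasDerivWithinAt (n := ⊤) (f := fun _ => geodesicField M)
    (u := M.carrier ×ˢ univ) ?_ (fun t ht => hγ.hasDerivWithinAt_prod ht)
    (fun t ht => ⟨hγ.mem t ht, trivial⟩)
  exact contDiffOn_geodesicField.comp contDiffOn_snd (fun z hz => hz.2)

theorem IsGeodesicFlow.contDiffOn (hγ : IsGeodesicFlow M T γ v) : ContDiffOn ℝ ∞ γ (Icc 0 T) :=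
  contDiff_fst.comp_contDiffOn hγ.contDiffOn_prod

theorem IsGeodesicFlow.velocity_eq (hT : 0 < T) (hγ : IsGeodesicFlow M T γ v) {t : ℝ}
    (ht : t ∈ Icc 0 T) : velocity γ T t = v t :=
  (hγ.hasDerivWithinAt t ht).derivWithin (uniqueDiffOn_Icc hT t ht)

theorem IsGeodesicFlow.isGeodesic (hT : 0 < T) (hγ : IsGeodesicFlow M T γ v) :
    IsGeodesic M T γ := by
  refine ⟨hγ.mem, hγ.contDiffOn.of_le (WithTop.coe_le_coe.mpr le_top), fun t ht k => ?_⟩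
  have h : HasDerivWithinAt (velocity γ T) (geodesicField M (γ t, v t)).2 (Icc 0 T) t :=
    (hγ.hasDerivWithinAt_velocity t ht).congr (fun s hs => hγ.velocity_eq hT hs)
      (hγ.velocity_eq hT ht)
  rw [h.derivWithin (uniqueDiffOn_Icc hT t ht), hγ.velocity_eq hT ht]
  exact neg_add_cancel _

theorem IsGeodesicFlow.eqOn {γ' v' : ℝ → Fin n → ℝ} (hγ : IsGeodesicFlow M T γ v)
    (hγ' : IsGeodesicFlow M T γ' v') (h0 : γ 0 = γ' 0) (h0' : v 0 = v' 0) :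
    EqOn γ γ' (Icc 0 T) := by
  have h := eqOn_of_hasDerivWithinAt isOpen_phaseSpace
    (contDiffOn_geodesicField.of_le (WithTop.coe_le_coe.mpr le_top))
    (fun t ht => hγ.hasDerivWithinAt_prod ht) (fun t ht => ⟨hγ.mem t ht, trivial⟩)
    (fun t ht => hγ'.hasDerivWithinAt_prod ht) (fun t ht => ⟨hγ'.mem t ht, trivial⟩)
    (Prod.ext h0 h0')
  exact fun t ht => congrArg Prod.fst (h ht)

/-- Uniqueness of geodesics makes the choice in `expMap` irrelevant. -/
theorem IsGeodesicFlow.expMap_eq (hγ : IsGeodesicFlow M 1 γ v) :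
    expMap M (γ 0) (v 0) = γ 1 := by
  have h : ∃ c : ℝ → Fin n → ℝ, IsGeodesic M 1 c ∧ c 0 = γ 0 ∧ velocity c 1 0 = v 0 :=
    ⟨γ, hγ.isGeodesic zero_lt_one, rfl, hγ.velocity_eq zero_lt_one ⟨le_rfl, zero_le_one⟩⟩
  rw [expMap, dif_pos h]
  obtain ⟨h1, h2, h3⟩ := h.choose_spec
  exact (h1.isGeodesicFlow zero_lt_one).eqOn hγ h2 h3 ⟨zero_le_one, le_rfl⟩

theorem IsGeodesicFlow.rescale (hT : 0 ≤ T) (hγ : IsGeodesicFlow M T γ v) :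
    IsGeodesicFlow M 1 (fun t => γ (T * t)) (fun t => T • v (T * t)) := by
  have hm : MapsTo (fun t => T * t) (Icc (0 : ℝ) 1) (Icc 0 T) := fun t ht =>
    ⟨mul_nonneg hT ht.1, mul_le_of_le_one_right hT ht.2⟩
  have hd {f : ℝ → Fin n → ℝ} {d : Fin n → ℝ} {t : ℝ}
      (hf : HasDerivWithinAt f d (Icc 0 T) (T * t)) :
      HasDerivWithinAt (fun s => f (T * s)) (T • d) (Icc 0 1) t := by
    have h1 : HasDerivWithinAt (fun s : ℝ => T * s) T (Icc 0 1) t := by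
      simpa using ((hasDerivAt_id t).const_mul T).hasDerivWithinAt
    exact HasDerivWithinAt.scomp t hf h1 hm
  refine ⟨fun t ht => hγ.mem _ (hm ht), fun t ht => hd (hγ.hasDerivWithinAt _ (hm ht)),
    fun t ht => ?_⟩
  have h := (hd (hγ.hasDerivWithinAt_velocity _ (hm ht))).const_smul T
  rw [smul_smul, ← sq, ← accel_smul] at h
  exact h

/-- The exponential map is differentiable, and its derivative is given by Jacobi fields. -/
theorem IsGeodesicFlow.exists_jacobiField (hγ : IsGeodesicFlow M 1 γ v) :
    ∃ 𝓙 𝓚 : ℝ → (Fin n → ℝ) →L[ℝ] (Fin n → ℝ),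
      HasFDerivAt (expMap M (γ 0)) (𝓙 1) (v 0) ∧
      (∀ w, IsJacobiField M γ v (fun t => 𝓙 t w) (fun t => 𝓚 t w)) ∧
      (∀ w, 𝓙 0 w = 0) ∧ ∀ w, 𝓚 0 w = w := by
  obtain ⟨Ψ, D, hΨ, hD, hD'⟩ := exists_differentiable_flow isOpen_phaseSpace
    (contDiffOn_geodesicField.of_le (WithTop.coe_le_coe.mpr le_top))
    (fun t ht => hγ.hasDerivWithinAt_prod ht) (fun t ht => ⟨hγ.mem t ht, trivial⟩)
  let inr := ContinuousLinearMap.inr ℝ (Fin n → ℝ) (Fin n → ℝ)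
  let fst := ContinuousLinearMap.fst ℝ (Fin n → ℝ) (Fin n → ℝ)
  let snd := ContinuousLinearMap.snd ℝ (Fin n → ℝ) (Fin n → ℝ)
  refine ⟨fun t => fst ∘L D t ∘L inr, fun t => snd ∘L D t ∘L inr, ?_, ?_, ?_, ?_⟩
  · have h1 : HasFDerivAt (fun w : Fin n → ℝ => (γ 0, w)) inr (v 0) :=
      hasFDerivAt_prodMk_right (γ 0) (v 0)
    have h2 : HasFDerivAt (fun w => (Ψ (γ 0, w) 1).1) (fst ∘L D 1 ∘L inr) (v 0) :=
      fst.hasFDerivAt.comp (v 0) ((hD 1 ⟨zero_le_one, le_rfl⟩).comp (v 0) h1)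
    refine h2.congr_of_eventuallyEq ?_
    -- For all initial velocities near `v 0` the flow supplies a geodesic on [0, 1], so the default
    -- value of `expMap` plays no role in the derivative.
    filter_upwards [h1.continuousAt.eventually hΨ] with w hw
    have h3 := (isGeodesicFlow_of_prod hw.2).expMap_eq
    rw [hw.1] at h3
    exact h3
  · intro w
    refine ⟨fun t ht => ?_, fun t ht => ?_⟩
    · have h := fst.hasFDerivAt.comp_hasDerivWithinAt t ((hD' (0, w)).2 t ht)
      refine h.congr_deriv ?_
      exact fderiv_geodesicField_fst (hγ.mem t ht) (v t) (D t (0, w)).1 (D t (0, w)).2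
    · refine ⟨_, snd.hasFDerivAt.comp_hasDerivWithinAt t ((hD' (0, w)).2 t ht), fun u => ?_⟩
      exact metricForm_fderiv_geodesicField_snd (hγ.mem t ht) (v t) (D t (0, w)).1
        (D t (0, w)).2 u
  · intro w
    exact congrArg Prod.fst (hD' (0, w)).1
  · intro w
    exact congrArg Prod.snd (hD' (0, w)).1

/-- The volume distortion of the exponential map along a geodesic of small curvature is positive,
and the same in both directions. -/
theorem IsGeodesicFlow.metricDet_pos_and_eq (hγ : IsGeodesicFlow M 1 γ v)
    (hR : ∀ t ∈ Icc (0 : ℝ) 1, frobeniusNorm M (γ t) (jacobiOperator M (γ t) (v t)) ≤ 1) :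
    0 < metricDet M (γ 0) (γ 1) (fderiv ℝ (expMap M (γ 0)) (v 0)) ∧
    metricDet M (γ 1) (γ 0) (fderiv ℝ (expMap M (γ 1)) (-v 1))
      = metricDet M (γ 0) (γ 1) (fderiv ℝ (expMap M (γ 0)) (v 0)) := by
  obtain ⟨𝓙, 𝓚, hL, hJ, hJ0, hK0⟩ := hγ.exists_jacobiField
  obtain ⟨𝓙', 𝓚', hL', hJ', hJ0', hK0'⟩ := hγ.reverse.exists_jacobiField
  rw [sub_zero] at hL'
  rw [hL.fderiv, hL'.fderiv]
  have hx := det_metric_pos (hγ.mem 0 ⟨le_rfl, zero_le_one⟩)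
  have hy := det_metric_pos (hγ.mem 1 ⟨zero_le_one, le_rfl⟩)
  have hdet := det_eq_of_metricForm_symm (hγ.mem 0 ⟨le_rfl, zero_le_one⟩)
    (hγ.mem 1 ⟨zero_le_one, le_rfl⟩) (L := 𝓙 1) (L' := 𝓙' 1) (fun u w => by
      have h := metricForm_jacobiField_symm hγ (hJ w) (hJ0 w) (hJ' u) (hJ0' u)
      simpa only [hK0, hK0'] using h)
  have hpos := det_jacobiField_pos hγ hR hJ hJ0 hK0
  have hsx := Real.sqrt_pos.mpr hx
  have hsy := Real.sqrt_pos.mpr hy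
  refine ⟨by unfold metricDet; positivity, ?_⟩
  unfold metricDet
  rw [div_eq_div_iff hsy.ne' hsx.ne']
  calc √(metric M (γ 0)).det * (𝓙' 1).det * √(metric M (γ 0)).det
      = √(metric M (γ 0)).det * √(metric M (γ 0)).det * (𝓙' 1).det := by ring
    _ = √(metric M (γ 1)).det * √(metric M (γ 1)).det * (𝓙 1).det := by
        rw [Real.mul_self_sqrt hx.le, Real.mul_self_sqrt hy.le, hdet]
    _ = √(metric M (γ 1)).det * (𝓙 1).det * √(metric M (γ 1)).det := by ring

end Exponential

end GeodesicWalk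

namespace GeodesicWalk

open Set Filter
open scoped Topology ContDiff Matrix ENNReal

/-! ### The trapezoidal rule -/

/-- As a function of the right endpoint s, the error has derivative ½(f'(s) - f'(0) - s f''(s)), and
that bracket has derivative -s f'''(s). Two mean value estimates give the constant 1/2, which is not
optimal but suffices. -/
theorem abs_trapezoid_error_le {f : ℝ → ℝ} {ℓ B : ℝ} (hℓ : 0 < ℓ)
    (hf : ContDiffOn ℝ 3 f (Icc 0 ℓ))
    (hB : ∀ t ∈ Icc 0 ℓ, |iteratedDerivWithin 3 f (Icc 0 ℓ) t| ≤ B) :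
    |f ℓ - f 0 - ℓ / 2 * (derivWithin f (Icc 0 ℓ) 0 + derivWithin f (Icc 0 ℓ) ℓ)|
      ≤ ℓ ^ 3 / 2 * B := by
  have hu := uniqueDiffOn_Icc hℓ
  have h0 : (0 : ℝ) ∈ Icc 0 ℓ := ⟨le_rfl, hℓ.le⟩
  have hl : ℓ ∈ Icc 0 ℓ := ⟨hℓ.le, le_rfl⟩
  set f1 := derivWithin f (Icc 0 ℓ) with hf1
  set f2 := derivWithin f1 (Icc 0 ℓ) with hf2
  set f3 := derivWithin f2 (Icc 0 ℓ) with hf3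
  have c1 : ContDiffOn ℝ 2 f1 (Icc 0 ℓ) := hf.derivWithin hu (by norm_num)
  have c2 : ContDiffOn ℝ 1 f2 (Icc 0 ℓ) := c1.derivWithin hu (by norm_num)
  have d0 : ∀ t ∈ Icc 0 ℓ, HasDerivWithinAt f (f1 t) (Icc 0 ℓ) t := fun t ht =>
    (hf.differentiableOn (by norm_num) t ht).hasDerivWithinAt
  have d1 : ∀ t ∈ Icc 0 ℓ, HasDerivWithinAt f1 (f2 t) (Icc 0 ℓ) t := fun t ht =>
    (c1.differentiableOn (by norm_num) t ht).hasDerivWithinAt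
  have d2 : ∀ t ∈ Icc 0 ℓ, HasDerivWithinAt f2 (f3 t) (Icc 0 ℓ) t := fun t ht =>
    (c2.differentiableOn (by norm_num) t ht).hasDerivWithinAt
  have hB3 : ∀ t ∈ Icc 0 ℓ, |f3 t| ≤ B := by
    intro t ht
    have h := hB t ht
    simp only [iteratedDerivWithin_succ, iteratedDerivWithin_zero] at h
    exact h
  have k1 : ∀ t ∈ Icc 0 ℓ, HasDerivWithinAt (fun s => f1 s - f1 0 - s * f2 s) (-(t * f3 t))
      (Icc 0 ℓ) t := by
    intro t ht
    refine (((d1 t ht).sub_const (f1 0)).sub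
      ((hasDerivWithinAt_id t _).mul (d2 t ht))).congr_deriv ?_
    simp
  have k2 : ∀ t ∈ Icc 0 ℓ, |f1 t - f1 0 - t * f2 t| ≤ ℓ ^ 2 * B := by
    intro t ht
    have h := (convex_Icc 0 ℓ).norm_image_sub_le_of_norm_hasDerivWithin_le (C := ℓ * B) k1
      (fun s hs => by
        rw [norm_neg, norm_mul, Real.norm_of_nonneg hs.1]
        exact mul_le_mul hs.2 (hB3 s hs) (abs_nonneg _) hℓ.le) h0 ht
    simp only [sub_self, zero_mul, sub_zero, Real.norm_eq_abs, abs_of_nonneg ht.1] at h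
    refine h.trans ?_
    have hB0 : 0 ≤ B := (abs_nonneg _).trans (hB3 t ht)
    calc ℓ * B * t ≤ ℓ * B * ℓ := mul_le_mul_of_nonneg_left ht.2 (by positivity)
      _ = ℓ ^ 2 * B := by ring
  have k3 : ∀ t ∈ Icc 0 ℓ, HasDerivWithinAt (fun s => f s - f 0 - s / 2 * (f1 0 + f1 s))
      ((1 / 2) * (f1 t - f1 0 - t * f2 t)) (Icc 0 ℓ) t := by
    intro t ht
    refine (((d0 t ht).sub_const (f 0)).sub (((hasDerivWithinAt_id t _).div_const 2).mul
      ((d1 t ht).const_add (f1 0)))).congr_deriv ?_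
    simp
    ring
  have h := (convex_Icc 0 ℓ).norm_image_sub_le_of_norm_hasDerivWithin_le
    (C := (1 / 2) * (ℓ ^ 2 * B)) k3 (fun s hs => by
      rw [norm_mul, Real.norm_of_nonneg (by norm_num : (0 : ℝ) ≤ 1 / 2), Real.norm_eq_abs]
      exact mul_le_mul_of_nonneg_left (k2 s hs) (by norm_num)) h0 hl
  simp only [sub_self, zero_div, zero_mul, sub_zero, Real.norm_eq_abs, abs_of_pos hℓ] at h
  refine h.trans (le_of_eq ?_)
  ring

/-! ### The acceptance ratio -/

section Ratio

set_option synthInstance.maxHeartbeats 200000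
set_option maxSynthPendingDepth 3

variable {n : ℕ} {M : HessianManifold n} {γ v : ℝ → Fin n → ℝ}

theorem le_goodSup {V : ℝ → (Fin n → ℝ) → (Fin n → ℝ) → ℝ} {V₀ H h : ℝ}
    (F : (ℝ → Fin n → ℝ) → ℝ → ℝ → ℝ) (h0 : 0 < h) (hH : h ≤ H)
    (hγ : IsGoodGeodesic M V V₀ h γ) {t : ℝ} (ht : t ∈ Icc 0 (stepLength n h)) :
    ENNReal.ofReal (F γ (stepLength n h) t) ≤ goodSup M V V₀ H F :=
  le_iSup_of_le h (le_iSup_of_le h0 (le_iSup_of_le hH (le_iSup_of_le γ (le_iSup_of_le hγ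
    (le_iSup_of_le t (le_iSup_of_le ht le_rfl))))))

/-- Reduces an estimate by a supremum in [0, ∞] to the finite case; an infinite supremum makes the
bound trivial because c > 0. -/
theorem ofReal_le_ofReal_mul {X c : ℝ} {S : ℝ≥0∞} (hc : 0 < c)
    (h : ∀ d : ℝ, 0 ≤ d → S = ENNReal.ofReal d → X ≤ c * d) :
    ENNReal.ofReal X ≤ ENNReal.ofReal c * S := by
  by_cases hS : S = ⊤
  · rw [hS, ENNReal.mul_top (ENNReal.ofReal_pos.mpr hc).ne']
    exact le_top
  · have h1 : S = ENNReal.ofReal S.toReal := (ENNReal.ofReal_toReal hS).symm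
    rw [h1, ← ENNReal.ofReal_mul hc.le]
    exact ENNReal.ofReal_le_ofReal (h _ ENNReal.toReal_nonneg h1)

/-- When q/p ≤ 1 this is log z ≤ z - 1 at z = q/p; otherwise the left side is zero. -/
theorem one_sub_min_le_abs_log {p q : ℝ} (hp : 0 < p) (hq : 0 < q) :
    1 - min 1 (q / p) ≤ |Real.log (p / q)| := by
  rcases le_total 1 (q / p) with h | h
  · rw [min_eq_left h, sub_self]
    exact abs_nonneg _
  · rw [min_eq_right h]
    have h1 := Real.log_le_sub_one_of_pos (div_pos hq hp)
    have h2 : Real.log (p / q) = -Real.log (q / p) := by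
      rw [← Real.log_inv, inv_div]
    refine le_trans ?_ (le_abs_self _)
    rw [h2]
    linarith

theorem metricNorm_sq_step {x : Fin n → ℝ} (hx : x ∈ M.carrier) {h : ℝ} (hh : 0 < h)
    (w : Fin n → ℝ) :
    metricNorm M x ((√h)⁻¹ • (w - (h / 2) • drift M x)) ^ 2
      = h⁻¹ * metricForm M x w w - metricForm M x (drift M x) w
        + h / 4 * metricForm M x (drift M x) (drift M x) := by
  rw [metricNorm_sq hx]
  simp only [map_smul, map_sub, smul_apply, sub_apply, smul_eq_mul]
  rw [metricForm_comm hx w (drift M x)]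
  have h1 : (√h)⁻¹ * (√h)⁻¹ = h⁻¹ := by rw [← mul_inv, Real.mul_self_sqrt hh.le]
  calc _ = (√h)⁻¹ * (√h)⁻¹ * (metricForm M x w w - h * metricForm M x (drift M x) w
        + h ^ 2 / 4 * metricForm M x (drift M x) (drift M x)) := by ring
    _ = _ := by
        rw [h1]
        field_simp

theorem IsGeodesicFlow.derivWithin_log_det {T : ℝ} (hT : 0 < T) (hγ : IsGeodesicFlow M T γ v)
    {t : ℝ} (ht : t ∈ Icc 0 T) :
    derivWithin (fun s => Real.log (metric M (γ s)).det) (Icc 0 T) t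
      = -2 * metricForm M (γ t) (drift M (γ t)) (v t) := by
  have hx := hγ.mem t ht
  have h := ((contDiffAt_log_det_metric hx).differentiableAt
    (by simp)).hasFDerivAt.comp_hasDerivWithinAt t (hγ.hasDerivWithinAt t ht)
  have h1 := h.derivWithin (uniqueDiffOn_Icc hT t ht)
  rw [metricForm_drift hx]
  refine h1.trans ?_
  ring

theorem IsGeodesicFlow.contDiffOn_log_det {T : ℝ} (hγ : IsGeodesicFlow M T γ v) :
    ContDiffOn ℝ ∞ (fun s => Real.log (metric M (γ s)).det) (Icc 0 T) := fun t ht =>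
  (contDiffAt_log_det_metric (hγ.mem t ht)).comp_contDiffWithinAt t (hγ.contDiffOn t ht)

theorem IsGeodesicFlow.differentiableOn_drift_norm {T : ℝ} (hγ : IsGeodesicFlow M T γ v) :
    DifferentiableOn ℝ (fun s => metricNorm M (γ s) (drift M (γ s)) ^ 2) (Icc 0 T) := by
  have h : ContDiffOn ℝ ∞ (fun s => metricForm M (γ s) (drift M (γ s)) (drift M (γ s)))
      (Icc 0 T) := fun t ht => by
    have hx := hγ.mem t ht
    have hg := (contDiffAt_metricForm hx).comp_contDiffWithinAt t (hγ.contDiffOn t ht)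
    have hd := (contDiffAt_drift hx).comp_contDiffWithinAt t (hγ.contDiffOn t ht)
    exact (hg.clm_apply hd).clm_apply hd
  exact (h.differentiableOn (by simp)).congr fun t ht => metricNorm_sq (hγ.mem t ht) _

/-- The logarithm of the ratio of the densities of a step and its reverse: the volume distortions
cancel, and the rest is the error of the trapezoidal rule for `log det g` and the change of the
norm of the drift. -/
theorem IsGeodesicFlow.log_stepDensity_div {ℓ h : ℝ} (hℓ : 0 < ℓ) (hh : 0 < h)
    (hγ : IsGeodesicFlow M ℓ γ v)
    (hR : ∀ t ∈ Icc 0 ℓ, ℓ ^ 2 * frobeniusNorm M (γ t) (jacobiOperator M (γ t) (v t)) ≤ 1) :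
    expMap M (γ 0) (ℓ • v 0) = γ ℓ ∧ expMap M (γ ℓ) (-(ℓ • v ℓ)) = γ 0 ∧
    0 < stepDensity M h (γ 0) (ℓ • v 0) ∧ 0 < stepDensity M h (γ ℓ) (-(ℓ • v ℓ)) ∧
    Real.log (stepDensity M h (γ 0) (ℓ • v 0) / stepDensity M h (γ ℓ) (-(ℓ • v ℓ)))
      = 1 / 2 * (Real.log (metric M (γ ℓ)).det - Real.log (metric M (γ 0)).det
        - ℓ / 2 * (derivWithin (fun s => Real.log (metric M (γ s)).det) (Icc 0 ℓ) 0
          + derivWithin (fun s => Real.log (metric M (γ s)).det) (Icc 0 ℓ) ℓ))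
        + h / 8 * (metricNorm M (γ ℓ) (drift M (γ ℓ)) ^ 2
          - metricNorm M (γ 0) (drift M (γ 0)) ^ 2) := by
  have h0 : (0 : ℝ) ∈ Icc 0 ℓ := ⟨le_rfl, hℓ.le⟩
  have hl : ℓ ∈ Icc 0 ℓ := ⟨hℓ.le, le_rfl⟩
  -- On [0, 1] the velocity is multiplied by ℓ and the curvature operator, quadratic in the
  -- velocity, by ℓ².
  have hs := hγ.rescale hℓ.le
  have hRs : ∀ t ∈ Icc (0 : ℝ) 1,
      frobeniusNorm M (γ (ℓ * t)) (jacobiOperator M (γ (ℓ * t)) (ℓ • v (ℓ * t))) ≤ 1 := by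
    intro t ht
    rw [jacobiOperator_smul, frobeniusNorm_smul (sq_nonneg ℓ)]
    exact hR _ ⟨mul_nonneg hℓ.le ht.1, mul_le_of_le_one_right hℓ.le ht.2⟩
  have e1 := hs.expMap_eq
  have e2 := hs.reverse.expMap_eq
  obtain ⟨hd, hd'⟩ := hs.metricDet_pos_and_eq hRs
  simp only [mul_zero, mul_one, sub_zero, sub_self] at e1 e2 hd hd'
  have hx := hγ.mem 0 h0
  have hy := hγ.mem ℓ hl
  have gx := det_metric_pos hx
  have gy := det_metric_pos hy
  have hspeed := hγ.metricForm_velocity hℓ.le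
  have hc : 0 < (2 * Real.pi * h) ^ n := by positivity
  unfold stepDensity
  rw [e1, e2, hd', metricNorm_sq_step hx hh, metricNorm_sq_step hy hh,
    hγ.derivWithin_log_det hℓ h0, hγ.derivWithin_log_det hℓ hl, metricNorm_sq hx,
    metricNorm_sq hy]
  set δ := metricDet M (γ 0) (γ ℓ) (fderiv ℝ (expMap M (γ 0)) (ℓ • v 0))
  have px : 0 < √((metric M (γ 0)).det / (2 * Real.pi * h) ^ n) :=
    Real.sqrt_pos.mpr (div_pos gx hc)
  have py : 0 < √((metric M (γ ℓ)).det / (2 * Real.pi * h) ^ n) :=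
    Real.sqrt_pos.mpr (div_pos gy hc)
  refine ⟨rfl, rfl, by positivity, by positivity, ?_⟩
  rw [Real.log_div (by positivity) (by positivity), Real.log_mul (by positivity) (by positivity),
    Real.log_mul (by positivity) (by positivity), Real.log_mul (by positivity) (by positivity),
    Real.log_mul (by positivity) (by positivity), Real.log_exp, Real.log_exp,
    Real.log_sqrt (by positivity), Real.log_sqrt (by positivity), Real.log_div gx.ne' hc.ne',
    Real.log_div gy.ne' hc.ne']
  simp only [map_neg, map_smul, neg_apply, smul_apply, smul_eq_mul]
  -- Equal speeds cancel the h⁻¹ terms. The sign of the reversed velocity turns the difference of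
  -- the cross terms into the sum of endpoint derivatives in the trapezoidal rule.
  rw [hspeed]
  ring

theorem stepDensity_pos_of_dim_zero {M : HessianManifold 0} {h : ℝ} (x v : Fin 0 → ℝ) :
    0 < stepDensity M h x v := by
  unfold stepDensity metricDet
  have h1 : (fderiv ℝ (expMap M x) v).det = 1 := LinearMap.det_eq_one_of_subsingleton _
  rw [h1]
  simp only [Matrix.det_isEmpty, pow_zero]
  positivity

end Ratio

end GeodesicWalk

/-! ### The main estimate. -/

open GeodesicWalk in
theorem mainTheorem3 :
    ∃ C : ℝ, 0 < C ∧
      ∀ (n : ℕ) (M : GeodesicWalk.HessianManifold n)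
        (V : ℝ → (Fin n → ℝ) → (Fin n → ℝ) → ℝ) (V₀ H h : ℝ)
        (γ : ℝ → Fin n → ℝ) (x y vx vy : Fin n → ℝ),
        0 < h → h ≤ H →
        ENNReal.ofReal h ≤ 1 / (n * GeodesicWalk.paramR1 M V V₀ H) →
        GeodesicWalk.IsGeodesic M (GeodesicWalk.stepLength n h) γ →
        V h (γ 0) (GeodesicWalk.velocity γ (GeodesicWalk.stepLength n h) 0) ≤ V₀ →
        γ 0 = x →
        γ (GeodesicWalk.stepLength n h) = y →
        GeodesicWalk.stepLength n h •
          GeodesicWalk.velocity γ (GeodesicWalk.stepLength n h) 0 = vx →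
        GeodesicWalk.stepLength n h •
          GeodesicWalk.velocity γ (GeodesicWalk.stepLength n h) (GeodesicWalk.stepLength n h)
            = -vy →
        GeodesicWalk.expMap M x vx = y ∧ GeodesicWalk.expMap M y vy = x ∧
        0 < GeodesicWalk.stepDensity M h x vx ∧ 0 < GeodesicWalk.stepDensity M h y vy ∧
        ENNReal.ofReal
            |Real.log (GeodesicWalk.stepDensity M h x vx / GeodesicWalk.stepDensity M h y vy)|
          ≤ ENNReal.ofReal C * GeodesicWalk.errorTerm M V V₀ H h ∧
        ENNReal.ofReal (GeodesicWalk.rejectionProb M h x vx y vy)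
          ≤ ENNReal.ofReal C * GeodesicWalk.errorTerm M V V₀ H h := by
  -- The estimates below give 1/4 for the G₁ term and 1/8 for the D₁ term, so 1 is ample.
  refine ⟨1, one_pos, ?_⟩
  intro n M V V₀ H h γ x y vx vy hh hH hhR hgeo hV hγx hγy hvx hvy
  suffices hmain : expMap M x vx = y ∧ expMap M y vy = x ∧
      0 < stepDensity M h x vx ∧ 0 < stepDensity M h y vy ∧
      ENNReal.ofReal |Real.log (stepDensity M h x vx / stepDensity M h y vy)|
        ≤ ENNReal.ofReal 1 * errorTerm M V V₀ H h by
    obtain ⟨h1, h2, h3, h4, h5⟩ := hmain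
    exact ⟨h1, h2, h3, h4, h5,
      (ENNReal.ofReal_le_ofReal (one_sub_min_le_abs_log h3 h4)).trans h5⟩
  -- In dimension 0 the parameter interval degenerates to a point; all points and vectors coincide
  -- and the ratio is 1.
  rcases Nat.eq_zero_or_pos n with hn | hn
  · subst hn
    refine ⟨Subsingleton.elim _ _, Subsingleton.elim _ _, stepDensity_pos_of_dim_zero _ _,
      stepDensity_pos_of_dim_zero _ _, ?_⟩
    rw [Subsingleton.elim y x, Subsingleton.elim vy vx,
      div_self (stepDensity_pos_of_dim_zero x vx).ne', Real.log_one, abs_zero, ENNReal.ofReal_zero]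
    exact bot_le
  have hn' : (0 : ℝ) < n := Nat.cast_pos.mpr hn
  have hgood : IsGoodGeodesic M V V₀ h γ := ⟨hgeo, hV⟩
  set ℓ := stepLength n h with hℓdef
  have hℓ2 : ℓ ^ 2 = n * h := Real.sq_sqrt (by positivity)
  have hℓ : 0 < ℓ := Real.sqrt_pos.mpr (by positivity)
  have hflow := hgeo.isGeodesicFlow hℓ
  have hR : ∀ t ∈ Set.Icc 0 ℓ,
      ℓ ^ 2 * frobeniusNorm M (γ t) (jacobiOperator M (γ t) (velocity γ ℓ t)) ≤ 1 := by
    intro t ht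
    have h1 : ENNReal.ofReal (frobeniusNorm M (γ t) (jacobiOperator M (γ t) (velocity γ ℓ t)))
        ≤ paramR1 M V V₀ H := le_goodSup (fun γ T t =>
          frobeniusNorm M (γ t) (jacobiOperator M (γ t) (velocity γ T t))) hh hH hgood ht
    -- Extended arithmetic covers R₁ = 0, where the product vanishes; R₁ = ∞ would contradict h > 0.
    -- With ℓ² = nh this is the curvature bound on the unit interval.
    have h2 := ENNReal.mul_le_of_le_div hhR
    rw [← ENNReal.ofReal_le_one, hℓ2, ENNReal.ofReal_mul (by positivity),
      ENNReal.ofReal_mul hn'.le, ENNReal.ofReal_natCast]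
    calc (n : ENNReal) * ENNReal.ofReal h * _ ≤ n * ENNReal.ofReal h * paramR1 M V V₀ H := by
          gcongr
      _ = ENNReal.ofReal h * (n * paramR1 M V V₀ H) := by ring
      _ ≤ 1 := h2
  obtain ⟨e1, e2, p1, p2, elog⟩ := hflow.log_stepDensity_div hℓ hh hR
  have hvy' : vy = -(ℓ • velocity γ ℓ ℓ) := by rw [hvy, neg_neg]
  subst hγx hγy hvx hvy'
  refine ⟨e1, e2, p1, p2, ?_⟩
  rw [elog, ENNReal.ofReal_one, one_mul]
  have hpow1 : (n * h) ^ (3 / 2 : ℝ) = ℓ ^ 3 := by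
    rw [hℓdef, stepLength, Real.sqrt_eq_rpow, ← Real.rpow_natCast, ← Real.rpow_mul (by positivity)]
    norm_num
  have hpow2 : √n * h ^ (3 / 2 : ℝ) = h * ℓ := by
    have h1 : h ^ (3 / 2 : ℝ) = h * √h := by
      rw [Real.sqrt_eq_rpow, ← Real.rpow_one_add' hh.le (by norm_num)]
      norm_num
    rw [h1, hℓdef, stepLength, Real.sqrt_mul hn'.le]
    ring
  set E := Real.log (metric M (γ ℓ)).det - Real.log (metric M (γ 0)).det
        - ℓ / 2 * (derivWithin (fun s => Real.log (metric M (γ s)).det) (Set.Icc 0 ℓ) 0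
          + derivWithin (fun s => Real.log (metric M (γ s)).det) (Set.Icc 0 ℓ) ℓ) with hE
  set F := metricNorm M (γ ℓ) (drift M (γ ℓ)) ^ 2 - metricNorm M (γ 0) (drift M (γ 0)) ^ 2 with hF
  have hD : ENNReal.ofReal (h / 8 * |F|)
      ≤ ENNReal.ofReal (√n * h ^ (3 / 2 : ℝ)) * paramD1 M V V₀ H := by
    refine ofReal_le_ofReal_mul (by positivity) fun d hd hS => ?_
    have hb : ∀ t ∈ Set.Icc 0 ℓ, ‖derivWithin (fun s => metricNorm M (γ s) (drift M (γ s)) ^ 2)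
        (Set.Icc 0 ℓ) t‖ ≤ d := by
      intro t ht
      have h1 := le_goodSup (fun γ T t => |derivWithin (fun s =>
        metricNorm M (γ s) (drift M (γ s)) ^ 2) (Set.Icc 0 T) t|) hh hH hgood ht
      exact (ENNReal.ofReal_le_ofReal_iff hd).mp (h1.trans_eq hS)
    have h2 := (convex_Icc 0 ℓ).norm_image_sub_le_of_norm_derivWithin_le
      hflow.differentiableOn_drift_norm hb ⟨le_rfl, hℓ.le⟩ ⟨hℓ.le, le_rfl⟩
    rw [sub_zero, Real.norm_of_nonneg hℓ.le, Real.norm_eq_abs, ← hF] at h2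
    rw [hpow2]
    nlinarith [mul_le_mul_of_nonneg_left h2 hh.le, mul_nonneg (mul_nonneg hh.le hℓ.le) hd]
  have hG : ENNReal.ofReal (1 / 2 * |E|)
      ≤ ENNReal.ofReal ((n * h) ^ (3 / 2 : ℝ)) * paramG1 M V V₀ H := by
    refine ofReal_le_ofReal_mul (by positivity) fun d hd hS => ?_
    have hb : ∀ t ∈ Set.Icc 0 ℓ, |iteratedDerivWithin 3
        (fun s => Real.log (metric M (γ s)).det) (Set.Icc 0 ℓ) t| ≤ d := by
      intro t ht
      have h1 := le_goodSup (fun γ T t => |iteratedDerivWithin 3 (fun s =>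
        Real.log (metric M (γ s)).det) (Set.Icc 0 T) t|) hh hH hgood ht
      exact (ENNReal.ofReal_le_ofReal_iff hd).mp (h1.trans_eq hS)
    have h2 := abs_trapezoid_error_le hℓ
      (hflow.contDiffOn_log_det.of_le (WithTop.coe_le_coe.mpr le_top)) hb
    rw [← hE] at h2
    rw [hpow1]
    nlinarith [mul_nonneg (pow_nonneg hℓ.le 3) hd]
  calc ENNReal.ofReal |1 / 2 * E + h / 8 * F|
      ≤ ENNReal.ofReal (h / 8 * |F| + 1 / 2 * |E|) := by
        refine ENNReal.ofReal_le_ofReal ((abs_add_le _ _).trans (le_of_eq ?_))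
        rw [abs_mul, abs_mul, abs_of_pos (show (0 : ℝ) < 1 / 2 by norm_num),
          abs_of_pos (show 0 < h / 8 by positivity), add_comm]
    _ = ENNReal.ofReal (h / 8 * |F|) + ENNReal.ofReal (1 / 2 * |E|) :=
        ENNReal.ofReal_add (by positivity) (by positivity)
    -- The curvature term is nonnegative and is simply added, since the volume distortions have
    -- cancelled exactly.
    _ ≤ errorTerm M V V₀ H h := (add_le_add hD hG).trans le_self_add
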